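/- (Heisenberg–Pauli–Weyl type inequalities for affine connections.) Let $(M^n,g)$ be a smooth $n$-dimensional Riemannian manifold with Levi-Civita connection and gradient both denoted by $\nabla$, Laplace–Beltrami operator $\Delta$ and Riemannian volume measure $dv_g$. Let $u\in C^\infty(M)$, $V=e^u$, $\lambda,\mu\in\mathbb{R}$ and $\tau=(n+1)\lambda+\mu$. For the affine connection $$D_XY=D^{\lambda,\mu}_XY=\nabla_XY+\lambda\,du(X)Y+\lambda\,du(Y)X+\mu\,g(X,Y)\nabla u,$$ the affine gradient and the affine Laplacian of a function $f$ are $$\nabla^Df=V^{\mu-\lambda}\nabla f,\qquad \Delta^Df=V^{\mu-\lambda}\bigl[\Delta f+(2\mu+n\lambda)\langle\nabla u,\nabla f\rangle\bigr].$$ Let $\rho$ be a continuous nonnegative function on $M$, let $\Omega=M\setminus\rho^{-1}\{0\}$, and let $C>0$ be a constant. Suppose that $|\nabla^D\rho|=1$ and $\Delta^D\rho\ge\frac{C}{\rho}V^{\lambda-\mu}$ hold on $\Omega$ in the sense of distributions, that is: (a) $\rho$ has on $\Omega$ a locally integrable distributional gradient $\nabla\rho$ (so $\int_M\langle\nabla\rho,X\rangle\,dv_g=-\int_M\rho\,\mathrm{div}X\,dv_g$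 for all smooth vector fields $X$ with compact support in $\Omega$), and $|V^{\mu-\lambda}\nabla\rho|=1$ almost everywhere on $\Omega$; (b) $\int_M\rho\,(\Delta^D\psi)\,V^\tau\,dv_g\ge\int_M\frac{C}{\rho}V^{\lambda-\mu}\,\psi\,V^\tau\,dv_g$ for all nonnegative $\psi\in C_0^\infty(\Omega)$. Then for every $\phi\in C_0^\infty(M\setminus\rho^{-1}\{0\})$, $$\left(\int_M\rho^2\phi^2V^{\tau+\lambda-\mu}\,dv_g\right)\left(\int_M|\nabla^D\phi|^2V^{\tau+\lambda-\mu}\,dv_g\right)\ge\frac{(C+1)^2}{4}\left(\int_M\phi^2V^{\tau+\lambda-\mu}\,dv_g\right)^2.$$ Moreover, if $C>1$, then $$\left(\int_M\rho^4\phi^2V^{\tau+\lambda-\mu}\,dv_g\right)\left(\int_M(\Delta^D\phi)^2V^{\tau+\mu-\lambda}\,dv_g\right)\ge\frac{(C+1)^4}{16}\left(\int_M\phi^2V^{\tau+\lambda-\mu}\,dv_g\right)^2.$$ -/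

import Mathlib

open MeasureTheory Set Bundle
open scoped Manifold ContDiff Topology

noncomputable section

namespace AffineHPW

/-- The model space `ℝⁿ` with its Euclidean structure. -/
abbrev Model (n : ℕ) : Type := EuclideanSpace ℝ (Fin n)

section Riemannian

variable {n : ℕ} {M : Type*} [TopologicalSpace M] [ChartedSpace (Model n) M]

instance tangentSpace_finiteDimensional (x : M) :
    FiniteDimensional ℝ (TangentSpace (𝓡 n) x) :=
  inferInstanceAs (FiniteDimensional ℝ (Model n))

variable [RiemannianBundle (fun x : M => TangentSpace (𝓡 n) x)]

instance tangentSpace_completeSpace (x : M) : CompleteSpace (TangentSpace (𝓡 n) x) :=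
  FiniteDimensional.complete ℝ (TangentSpace (𝓡 n) x)

/-- The Riemannian gradient `∇f`: the vector field with `⟨∇f, w⟩ = df(w)` for all tangent
vectors `w`. -/
def grad (f : M → ℝ) (x : M) : TangentSpace (𝓡 n) x :=
  (InnerProductSpace.toDual ℝ (TangentSpace (𝓡 n) x)).symm (mvfderiv (𝓡 n) f x)

/-- The coordinate vector field `∂/∂xⁱ` of the chart at `c`, at the point with coordinates `p`. -/
def coordField (c : M) (p : Model n) (i : Fin n) :
    TangentSpace (𝓡 n) ((chartAt (Model n) c).symm p) :=
  mfderiv 𝓘(ℝ, Model n) (𝓡 n) (chartAt (Model n) c).symm p (EuclideanSpace.single i (1 : ℝ))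

/-- The matrix `g_{ij}` of the metric in the chart at `c`, as a function of the coordinates `p`. -/
def gramMatrix (c : M) (p : Model n) : Matrix (Fin n) (Fin n) ℝ :=
  Matrix.of fun i j => inner ℝ (coordField c p i) (coordField c p j)

/-- The Riemannian volume density `√(det g_{ij})` in the chart at `c`. -/
def volDensity (c : M) (p : Model n) : ℝ := Real.sqrt (gramMatrix c p).det

/-- The `i`-th component `Xⁱ = dxⁱ(X)` of a vector field in the chart at `c`, as a function of the
coordinates `p`. -/
def coordComp (c : M) (X : ∀ x : M, TangentSpace (𝓡 n) x) (p : Model n) (i : Fin n) : ℝ :=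
  mvfderiv (𝓡 n) (fun y : M => chartAt (Model n) c y i) ((chartAt (Model n) c).symm p)
    (X ((chartAt (Model n) c).symm p))

/-- The Riemannian divergence `div X = (det g)^{-1/2} ∑ᵢ ∂ᵢ((det g)^{1/2} Xⁱ)`, computed at `x` in
the chart at `x`. -/
def divergence (X : ∀ x : M, TangentSpace (𝓡 n) x) (x : M) : ℝ :=
  (volDensity x (chartAt (Model n) x x))⁻¹ *
    ∑ i : Fin n, fderiv ℝ (fun p : Model n => volDensity x p * coordComp x X p i)
      (chartAt (Model n) x x) (EuclideanSpace.single i (1 : ℝ))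

/-- The Laplace–Beltrami operator `Δf = div ∇f`. -/
def laplacian (f : M → ℝ) (x : M) : ℝ := divergence (n := n) (fun y : M => grad f y) x

variable [MeasurableSpace M]

/-- The Riemannian volume of the domain of the chart at `c`: the image under the inverse chart of
`√(det g) dx` on the target of the chart. -/
def chartVolume (c : M) : Measure M :=
  ((volume.restrict (chartAt (Model n) c).target).withDensity
    fun p => ENNReal.ofReal (volDensity c p)).map (chartAt (Model n) c).symm

variable (n M) in
/-- The Riemannian volume measure `dv_g`. The measures `chartVolume c` agree on overlaps of chart
domains, so their supremum is the measure that restricts to `chartVolume c` on the domain of the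
chart at `c`, for every `c`. -/
def riemannianVolume : Measure M := ⨆ c : M, chartVolume (n := n) c

/-- `G` is the distributional gradient of `ρ` on the open set `Ω`:
`∫ ⟨G, X⟩ dv_g = - ∫ ρ div X dv_g` for all smooth vector fields `X` with compact support in `Ω`.
The integrability of all the functions `⟨G, X⟩` says that `G` is measurable and locally integrable
on `Ω`. -/
def IsWeakGradientOn [IsManifold (𝓡 n) 1 M] (Ω : Set M) (ρ : M → ℝ) (G : ∀ x : M, TangentSpace (𝓡 n) x) : Prop :=
  ∀ X : ∀ x : M, TangentSpace (𝓡 n) x,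
    ContMDiff (𝓡 n) (𝓡 n).tangent ∞ (fun x => (⟨x, X x⟩ : TangentBundle (𝓡 n) M)) →
    (∃ K : Set M, IsCompact K ∧ K ⊆ Ω ∧ ∀ x ∉ K, X x = 0) →
    Integrable (fun x => inner ℝ (G x) (X x)) (riemannianVolume n M) ∧
    ∫ x, inner ℝ (G x) (X x) ∂(riemannianVolume n M) =
      - ∫ x, ρ x * divergence X x ∂(riemannianVolume n M)

end Riemannian

section Affine

/-- The weight `V = e^u` of the Riemannian triple `(M, g, V)`. -/
def weight {M : Type*} (u : M → ℝ) (x : M) : ℝ := Real.exp (u x)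

/-- The exponent `τ = (n + 1) λ + μ`. -/
def tau (n : ℕ) (lam mu : ℝ) : ℝ := ((n : ℝ) + 1) * lam + mu

variable {n : ℕ} {M : Type*} [TopologicalSpace M] [ChartedSpace (Model n) M]
  [RiemannianBundle (fun x : M => TangentSpace (𝓡 n) x)]

/-- The affine gradient `∇^D f = V^{μ-λ} ∇f`. -/
def affineGrad (lam mu : ℝ) (u f : M → ℝ) (x : M) : TangentSpace (𝓡 n) x :=
  (weight u x ^ (mu - lam)) • grad f x

/-- The affine Laplacian `Δ^D f = V^{μ-λ} (Δf + (2μ + nλ) ⟨∇u, ∇f⟩)`. -/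
def affineLaplacian (lam mu : ℝ) (u f : M → ℝ) (x : M) : ℝ :=
  weight u x ^ (mu - lam) *
    (laplacian (n := n) f x + (2 * mu + n * lam) * inner ℝ (grad (n := n) u x) (grad f x))

variable [MeasurableSpace M]

variable (n) in
/-- `|∇^D ρ| = 1` on the open set `Ω` in the sense of distributions: `ρ` has a distributional
gradient `G` on `Ω`, and `|V^{μ-λ} G| = 1` almost everywhere on `Ω`. -/
def UnitAffineGradientOn [IsManifold (𝓡 n) 1 M] (Ω : Set M) (lam mu : ℝ) (u ρ : M → ℝ) : Prop :=
  ∃ G : ∀ x : M, TangentSpace (𝓡 n) x, IsWeakGradientOn Ω ρ G ∧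
    ∀ᵐ x ∂(riemannianVolume n M), x ∈ Ω → ‖(weight u x ^ (mu - lam)) • G x‖ = 1

variable (n) in
/-- `Δ^D ρ ≥ h` on the open set `Ω` in the sense of distributions, for `ρ` and `h` continuous
on `Ω`. On smooth functions the operator `Δ^D` is symmetric with respect to `V^τ dv_g`, so the
inequality is tested as `∫ ρ (Δ^D ψ) V^τ dv_g ≥ ∫ h ψ V^τ dv_g` for all smooth `ψ ≥ 0` with
compact support in `Ω`. -/
def AffineLaplacianGEOn (Ω : Set M) (lam mu : ℝ) (u ρ h : M → ℝ) : Prop :=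
  ∀ ψ : M → ℝ, ContMDiff (𝓡 n) 𝓘(ℝ, ℝ) ∞ ψ → HasCompactSupport ψ → tsupport ψ ⊆ Ω →
    (∀ x, 0 ≤ ψ x) →
    ∫ x, h x * ψ x * weight u x ^ tau n lam mu ∂(riemannianVolume n M) ≤
      ∫ x, ρ x * affineLaplacian (n := n) lam mu u ψ x * weight u x ^ tau n lam mu
        ∂(riemannianVolume n M)

end Affine

end AffineHPW

end

/-! Write Ω = {ρ ≠ 0}, α = τ + λ - μ and k = nλ + 2μ = τ + μ - λ. The drift term in Δ^D is exactly
the one for which V^τ Δ^D f = div(V^k ∇f) (`affineLaplacian_mul_weight`). If G is the distributional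
gradient of ρ, hypothesis (b) therefore reads C ∫ ρ⁻¹ ψ V^α + ∫ V^k ⟨G, ∇ψ⟩ ≤ 0 for all test
functions ψ ≥ 0.

Take formally ψ = ρη with η ≥ 0. Since ⟨G, ∇(ρη)⟩ = η|G|² + ρ⟨G, ∇η⟩ and V^k |G|² = V^α, this gives
(C + 1) ∫ η V^α + ∫ ρ V^k ⟨G, ∇η⟩ ≤ 0 (`energy_inequality`). With η = φ² and |V^(μ-λ) G| = 1, the
second term is at least -2 ∫ ρ |φ| |∇^D φ| V^α, and Cauchy–Schwarz gives the first order inequality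
(`heisenberg_first_order`).

For the second order, two more applications of Cauchy–Schwarz bound the squares of ∫ ρ²φ²V^α and ∫
|∇^D φ|² V^α by ∫ φ²V^α times the fourth moment and times the integral of (Δ^D φ)² respectively; the
latter uses Green's formula (`sq_integral_sq_mul_le`, `sq_integral_affineGrad_le`). Squaring the
first order inequality and cancelling (∫ φ²V^α)² finishes the proof.

The analytic difficulty is that ρη is not smooth. For η supported in one chart, ρ is mollified in
coordinates: the partial derivatives of the mollifications are mollifications of the components ⟨G,
∂ᵢ⟩, which are locally bounded because |G| = V^(λ-μ), and dominated convergence passes to the limit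
(`exists_mollification`, `local_energy_inequality`). The resulting inequality is additive in η, so a
partition of unity globalises it.

The remaining work builds the Riemannian calculus: the volume in a chart, the chart independence of
the divergence, integration by parts and smoothness of gradients. -/

noncomputable section

namespace AffineHPW

variable {n : ℕ} {M : Type*} [TopologicalSpace M] [ChartedSpace (Model n) M]

/-! ### Tangent vectors in chart coordinates and changes of charts. -/

section Charts

theorem mvfderiv_model {E : Type*} [NormedAddCommGroup E] [NormedSpace ℝ E] (f : E → ℝ) (p w : E) :
    mvfderiv 𝓘(ℝ, E) f p w = fderiv ℝ f p w := by
  simp only [mvfderiv, mfderiv_eq_fderiv]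
  rfl

variable [IsManifold (𝓡 n) 1 M]

/-- Components of tangent vectors in the chart at `c`. -/
def coords (c x : M) : TangentSpace (𝓡 n) x →L[ℝ] Model n :=
  (trivializationAt (Model n) (TangentSpace (𝓡 n)) c).continuousLinearMapAt ℝ x

/-- The tangent vector with given components in the chart at `c`. -/
def vec (c x : M) : Model n →L[ℝ] TangentSpace (𝓡 n) x :=
  (trivializationAt (Model n) (TangentSpace (𝓡 n)) c).symmL ℝ x

variable {c x : M}

theorem coords_vec (hx : x ∈ (chartAt (Model n) c).source) (w : Model n) :
    coords c x (vec c x w) = w :=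
  (trivializationAt (Model n) (TangentSpace (𝓡 n)) c).continuousLinearMapAt_symmL (R := ℝ)
    (by simpa using hx) w

theorem vec_coords (hx : x ∈ (chartAt (Model n) c).source) (v : TangentSpace (𝓡 n) x) :
    vec c x (coords c x v) = v :=
  (trivializationAt (Model n) (TangentSpace (𝓡 n)) c).symmL_continuousLinearMapAt (R := ℝ)
    (by simpa using hx) v

theorem vec_apply (hx : x ∈ (chartAt (Model n) c).source) (w : Model n) :
    vec c x w = mfderiv 𝓘(ℝ, Model n) (𝓡 n) (chartAt (Model n) c).symm (chartAt (Model n) c x) w := by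
  have h := TangentBundle.symmL_trivializationAt (I := 𝓡 n) (𝕜 := ℝ) hx
  have := congrArg (fun L => L w) h
  simpa using! this

theorem coords_apply (hx : x ∈ (chartAt (Model n) c).source) (v : TangentSpace (𝓡 n) x) :
    coords c x v = mfderiv (𝓡 n) 𝓘(ℝ, Model n) (chartAt (Model n) c) x v := by
  have h := TangentBundle.continuousLinearMapAt_trivializationAt (I := 𝓡 n) (𝕜 := ℝ) hx
  have := congrArg (fun L => L v) h
  simpa using! this

theorem mdifferentiableAt_chart (hx : x ∈ (chartAt (Model n) c).source) :
    MDifferentiableAt (𝓡 n) 𝓘(ℝ, Model n) (chartAt (Model n) c) x :=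
  mdifferentiableAt_atlas (chart_mem_atlas _ c) hx

theorem coords_apply_coord (hx : x ∈ (chartAt (Model n) c).source) (v : TangentSpace (𝓡 n) x)
    (i : Fin n) :
    coords c x v i = mvfderiv (𝓡 n) (fun y : M => chartAt (Model n) c y i) x v := by
  rw [coords_apply hx]
  have h1 : HasMFDerivAt (𝓡 n) 𝓘(ℝ, Model n) (chartAt (Model n) c) x _ :=
    (mdifferentiableAt_chart hx).hasMFDerivAt
  have h2 := ((EuclideanSpace.proj (𝕜 := ℝ) i : Model n →L[ℝ] ℝ).hasMFDerivAt
    (x := chartAt (Model n) c x)).comp x h1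
  have h3 := congrArg (fun L => L v) h2.mfderiv
  exact h3.symm

theorem mvfderiv_vec (hx : x ∈ (chartAt (Model n) c).source) {f : M → ℝ}
    (hf : MDifferentiableAt (𝓡 n) 𝓘(ℝ, ℝ) f x) (w : Model n) :
    mvfderiv (𝓡 n) f x (vec c x w) =
      fderiv ℝ (f ∘ (chartAt (Model n) c).symm) (chartAt (Model n) c x) w := by
  rw [vec_apply hx]
  have hx' := (chartAt (Model n) c).map_source hx
  have h1 : MDifferentiableAt 𝓘(ℝ, Model n) (𝓡 n) (chartAt (Model n) c).symm
      (chartAt (Model n) c x) := mdifferentiableAt_atlas_symm (chart_mem_atlas _ c) hx'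
  have hl := (chartAt (Model n) c).left_inv hx
  have h2 := mvfderiv_comp_apply_of_eq _ hf h1 hl w
  exact h2.symm.trans (mvfderiv_model _ _ _)

theorem coordField_eq_vec {p : Model n} (hp : p ∈ (chartAt (Model n) c).target) (i : Fin n) :
    coordField c p i = vec c ((chartAt (Model n) c).symm p) (EuclideanSpace.single i 1) := by
  rw [vec_apply ((chartAt (Model n) c).map_target hp), (chartAt (Model n) c).right_inv hp]
  rfl

theorem coordComp_eq_coords (X : ∀ x : M, TangentSpace (𝓡 n) x) {p : Model n}
    (hp : p ∈ (chartAt (Model n) c).target) (i : Fin n) :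
    coordComp c X p i =
      coords c ((chartAt (Model n) c).symm p) (X ((chartAt (Model n) c).symm p)) i := by
  rw [coords_apply_coord ((chartAt (Model n) c).map_target hp)]
  rfl

/-- The Jacobian matrix of the change of charts. -/
def jac (c d : M) (p : Model n) : Model n →L[ℝ] Model n :=
  fderiv ℝ (chartAt (Model n) d ∘ (chartAt (Model n) c).symm) p

theorem vec_change {c d x : M} (hc : x ∈ (chartAt (Model n) c).source)
    (hd : x ∈ (chartAt (Model n) d).source) (w : Model n) :
    vec c x w = vec d x (jac c d (chartAt (Model n) c x) w) := by
  rw [← vec_coords hd (vec c x w)]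
  congr 1
  have hl := (chartAt (Model n) c).left_inv hc
  have h1 : MDifferentiableAt 𝓘(ℝ, Model n) (𝓡 n) (chartAt (Model n) c).symm
      (chartAt (Model n) c x) := mdifferentiableAt_atlas_symm (chart_mem_atlas _ c)
        ((chartAt (Model n) c).map_source hc)
  rw [coords_apply hd, vec_apply hc]
  have h2 := mfderiv_comp_apply_of_eq _ (mdifferentiableAt_chart hd) h1 hl w
  rw [mfderiv_eq_fderiv] at h2
  exact h2.symm

theorem linearIndependent_vec (hx : x ∈ (chartAt (Model n) c).source) :
    LinearIndependent ℝ fun i : Fin n => vec c x (EuclideanSpace.single i 1) := by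
  have h : LinearIndependent ℝ fun i : Fin n => (EuclideanSpace.single i 1 : Model n) := by
    have := (EuclideanSpace.basisFun (Fin n) ℝ).toBasis.linearIndependent
    have h2 : (⇑(EuclideanSpace.basisFun (Fin n) ℝ).toBasis : Fin n → Model n) =
        fun i : Fin n => EuclideanSpace.single i 1 := by
      ext1 i
      simp
    rwa [h2] at this
  refine h.map' (vec c x).toLinearMap (LinearMap.ker_eq_bot.2 ?_)
  exact Function.LeftInverse.injective (g := coords c x) fun w => coords_vec hx w

theorem hasFDerivAt_chart_change {c d x : M} (hc : x ∈ (chartAt (Model n) c).source)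
    (hd : x ∈ (chartAt (Model n) d).source) :
    HasFDerivAt (chartAt (Model n) d ∘ (chartAt (Model n) c).symm)
      (jac c d (chartAt (Model n) c x)) (chartAt (Model n) c x) := by
  have hl := (chartAt (Model n) c).left_inv hc
  have h1 : MDifferentiableAt 𝓘(ℝ, Model n) (𝓡 n) (chartAt (Model n) c).symm
      (chartAt (Model n) c x) := mdifferentiableAt_atlas_symm (chart_mem_atlas _ c)
        ((chartAt (Model n) c).map_source hc)
  have h2 : MDifferentiableAt 𝓘(ℝ, Model n) 𝓘(ℝ, Model n)
      (chartAt (Model n) d ∘ (chartAt (Model n) c).symm) (chartAt (Model n) c x) :=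
    MDifferentiableAt.comp_of_eq _ (mdifferentiableAt_chart hd) h1 hl
  exact (mdifferentiableAt_iff_differentiableAt.1 h2).hasFDerivAt

end Charts

/-! ### Smoothness of functions and vector fields read in charts. -/

section Smooth
variable [IsManifold (𝓡 n) ∞ M]
variable {c x : M}

theorem contDiffAt_comp_chart_symm {f : M → ℝ} (hx : x ∈ (chartAt (Model n) c).source)
    (hf : ContMDiffAt (𝓡 n) 𝓘(ℝ, ℝ) ∞ f x) :
    ContDiffAt ℝ ∞ (f ∘ (chartAt (Model n) c).symm) (chartAt (Model n) c x) := by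
  have h1 : ContMDiffAt 𝓘(ℝ, Model n) (𝓡 n) ∞ (chartAt (Model n) c).symm
      (chartAt (Model n) c x) :=
    (contMDiffOn_chart_symm (I := 𝓡 n) (x := c)).contMDiffAt
      ((chartAt (Model n) c).open_target.mem_nhds ((chartAt (Model n) c).map_source hx))
  rw [← contMDiffAt_iff_contDiffAt]
  exact ContMDiffAt.comp_of_eq hf h1 ((chartAt (Model n) c).left_inv hx)

theorem contMDiffAt_comp_chart {F : Type*} [NormedAddCommGroup F] [NormedSpace ℝ F]
    {f : Model n → F} (hx : x ∈ (chartAt (Model n) c).source)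
    (hf : ContDiffAt ℝ ∞ f (chartAt (Model n) c x)) :
    ContMDiffAt (𝓡 n) 𝓘(ℝ, F) ∞ (fun y => f (chartAt (Model n) c y)) x := by
  have h1 : ContMDiffAt (𝓡 n) 𝓘(ℝ, Model n) ∞ (chartAt (Model n) c) x :=
    (contMDiffOn_chart (I := 𝓡 n) (x := c)).contMDiffAt
      ((chartAt (Model n) c).open_source.mem_nhds hx)
  exact hf.contMDiffAt.comp x h1

theorem contMDiffAt_coords_iff (hx : x ∈ (chartAt (Model n) c).source)
    {X : ∀ x : M, TangentSpace (𝓡 n) x} :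
    ContMDiffAt (𝓡 n) (𝓡 n).tangent ∞ (fun y => (⟨y, X y⟩ : TangentBundle (𝓡 n) M)) x ↔
      ContMDiffAt (𝓡 n) 𝓘(ℝ, Model n) ∞ (fun y => coords c y (X y)) x := by
  have h := (trivializationAt (Model n) (TangentSpace (𝓡 n)) c).contMDiffAt_section_iff
    (IB := 𝓡 n) (n := ∞) (s := X) (x₀ := x) (by simpa using hx)
  refine h.trans ?_
  apply Filter.EventuallyEq.contMDiffAt_iff
  filter_upwards [(chartAt (Model n) c).open_source.mem_nhds hx] with y hy
  have hy' : y ∈ (trivializationAt (Model n) (TangentSpace (𝓡 n)) c).baseSet := by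
    simpa using hy
  simp only [coords]
  rw [Trivialization.continuousLinearMapAt_apply, Trivialization.linearMapAt_apply, if_pos hy']

theorem contMDiffAt_vec (hx : x ∈ (chartAt (Model n) c).source) (w : Model n) :
    ContMDiffAt (𝓡 n) (𝓡 n).tangent ∞ (fun y => (⟨y, vec c y w⟩ : TangentBundle (𝓡 n) M)) x := by
  rw [contMDiffAt_coords_iff hx]
  apply (contMDiffAt_const (c := w)).congr_of_eventuallyEq
  filter_upwards [(chartAt (Model n) c).open_source.mem_nhds hx] with y hy
  exact coords_vec hy w

end Smooth

/-! ### The Gram matrix and the volume density. -/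

section Density

variable [RiemannianBundle (fun x : M => TangentSpace (𝓡 n) x)]

/-- The Gram matrix of the coordinate fields of the chart at `c`, as a function on `M`. -/
def gramAt (n : ℕ) {M : Type*} [TopologicalSpace M] [ChartedSpace (Model n) M]
    [RiemannianBundle (fun x : M => TangentSpace (𝓡 n) x)] [IsManifold (𝓡 n) 1 M] (c x : M) : Matrix (Fin n) (Fin n) ℝ :=
  Matrix.gram ℝ fun i : Fin n => vec c x (EuclideanSpace.single i 1)

section
variable [IsManifold (𝓡 n) 1 M] {c x : M}

theorem gramMatrix_eq_gramAt {p : Model n} (hp : p ∈ (chartAt (Model n) c).target) :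
    gramMatrix c p = gramAt n c ((chartAt (Model n) c).symm p) := by
  ext i j
  simp only [gramMatrix, gramAt, Matrix.of_apply, Matrix.gram_apply, coordField_eq_vec hp]

theorem volDensity_chart (hx : x ∈ (chartAt (Model n) c).source) :
    volDensity c (chartAt (Model n) c x) = Real.sqrt (gramAt n c x).det := by
  rw [volDensity, gramMatrix_eq_gramAt ((chartAt (Model n) c).map_source hx),
    (chartAt (Model n) c).left_inv hx]

theorem gramAt_posDef (hx : x ∈ (chartAt (Model n) c).source) : (gramAt n c x).PosDef :=
  Matrix.posDef_gram_of_linearIndependent (linearIndependent_vec hx)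

theorem gramAt_det_pos (hx : x ∈ (chartAt (Model n) c).source) : 0 < (gramAt n c x).det :=
  (gramAt_posDef hx).det_pos

theorem volDensity_pos {p : Model n} (hp : p ∈ (chartAt (Model n) c).target) :
    0 < volDensity c p := by
  rw [volDensity, gramMatrix_eq_gramAt hp]
  exact Real.sqrt_pos.2 (gramAt_det_pos ((chartAt (Model n) c).map_target hp))

/-- A vector of the model is the sum of its components along the standard basis. -/
theorem model_eq_sum (w : Model n) :
    w = ∑ i : Fin n, w i • (EuclideanSpace.single i 1 : Model n) := by
  simpa using ((EuclideanSpace.basisFun (Fin n) ℝ).sum_repr w).symm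

theorem gramAt_change {c d x : M} (hc : x ∈ (chartAt (Model n) c).source)
    (hd : x ∈ (chartAt (Model n) d).source) :
    (gramAt n c x).det = (jac c d (chartAt (Model n) c x)).det ^ 2 * (gramAt n d x).det := by
  set J := jac c d (chartAt (Model n) c x)
  set b := (EuclideanSpace.basisFun (Fin n) ℝ).toBasis
  set A := LinearMap.toMatrix b b J.toLinearMap
  have hA : J.det = A.det := (LinearMap.det_toMatrix b J.toLinearMap).symm
  -- The frame of `c` is the frame of `d` transformed by the Jacobian matrix, so the two Gram
  -- matrices are congruent; taking determinants gives the square of the Jacobian determinant.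
  have hkey : gramAt n c x = A.transpose * gramAt n d x * A := by
    have hv (i : Fin n) : vec c x (EuclideanSpace.single i 1) =
        ∑ k, A k i • vec d x (EuclideanSpace.single k 1) := by
      rw [vec_change hc hd]
      conv_lhs => rw [model_eq_sum (jac c d (chartAt (Model n) c x) (EuclideanSpace.single i 1))]
      rw [map_sum]
      refine Finset.sum_congr rfl fun k _ => ?_
      rw [map_smul]
      congr 1
    ext i j
    simp only [gramAt, Matrix.gram_apply, Matrix.mul_apply, hv i, hv j, sum_inner, inner_sum,
      inner_smul_left, inner_smul_right, Matrix.transpose_apply, Finset.sum_mul, Finset.mul_sum]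
    refine Finset.sum_congr rfl fun k _ => Finset.sum_congr rfl fun l _ => ?_
    rw [real_inner_comm]
    simp only [conj_trivial]
    ring
  rw [hkey, Matrix.det_mul, Matrix.det_mul, Matrix.det_transpose, hA]; ring

theorem volDensity_change {c d x : M} (hc : x ∈ (chartAt (Model n) c).source)
    (hd : x ∈ (chartAt (Model n) d).source) :
    volDensity c (chartAt (Model n) c x) =
      |(jac c d (chartAt (Model n) c x)).det| * volDensity d (chartAt (Model n) d x) := by
  rw [volDensity_chart hc, volDensity_chart hd, gramAt_change hc hd,
    Real.sqrt_mul (sq_nonneg _), Real.sqrt_sq_eq_abs]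

end

section
variable [IsManifold (𝓡 n) ∞ M]
  [IsContMDiffRiemannianBundle (𝓡 n) ∞ (Model n) (fun x : M => TangentSpace (𝓡 n) x)]
  {c x : M}

theorem contMDiffAt_gramAt (hx : x ∈ (chartAt (Model n) c).source) (i j : Fin n) :
    ContMDiffAt (𝓡 n) 𝓘(ℝ, ℝ) ∞ (fun y => gramAt n c y i j) x := by
  simp only [gramAt, Matrix.gram_apply]
  exact ContMDiffAt.inner_bundle (contMDiffAt_vec hx _) (contMDiffAt_vec hx _)

theorem contDiffAt_matrix_det {E : Type*} [NormedAddCommGroup E] [NormedSpace ℝ E]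
    {A : E → Matrix (Fin n) (Fin n) ℝ} {p : E}
    (hA : ∀ i j, ContDiffAt ℝ ∞ (fun q => A q i j) p) :
    ContDiffAt ℝ ∞ (fun q => (A q).det) p := by
  simp only [Matrix.det_apply]
  refine ContDiffAt.sum fun σ _ => ?_
  refine ContDiffAt.const_smul _ ?_
  exact contDiffAt_prod fun i _ => hA _ _

theorem contDiffAt_gramMatrix {p : Model n} (hp : p ∈ (chartAt (Model n) c).target)
    (i j : Fin n) : ContDiffAt ℝ ∞ (fun q => gramMatrix c q i j) p := by
  have h := contDiffAt_comp_chart_symm ((chartAt (Model n) c).map_target hp)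
    (contMDiffAt_gramAt ((chartAt (Model n) c).map_target hp) i j)
  rw [(chartAt (Model n) c).right_inv hp] at h
  apply h.congr_of_eventuallyEq
  filter_upwards [(chartAt (Model n) c).open_target.mem_nhds hp] with q hq
  rw [gramMatrix_eq_gramAt hq]; rfl

theorem contDiffAt_volDensity {p : Model n} (hp : p ∈ (chartAt (Model n) c).target) :
    ContDiffAt ℝ ∞ (volDensity c) p := by
  have h := contDiffAt_matrix_det (fun i j => contDiffAt_gramMatrix hp i j)
  refine h.sqrt ?_
  have := volDensity_pos hp
  exact (Real.sqrt_pos.1 this).ne'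

theorem continuousOn_volDensity (c : M) :
    ContinuousOn (volDensity (n := n) c) (chartAt (Model n) c).target := fun _ hp =>
  (contDiffAt_volDensity hp).continuousAt.continuousWithinAt

theorem aemeasurable_volDensity (c : M) :
    AEMeasurable (fun p : Model n => ENNReal.ofReal (volDensity c p))
      (volume.restrict (chartAt (Model n) c).target) :=
  ((continuousOn_volDensity c).aemeasurable
    (chartAt (Model n) c).open_target.measurableSet).ennreal_ofReal

end
end Density

/-! ### Consistency of the chart volumes. -/

section Volume

variable [MeasurableSpace M] [BorelSpace M]

theorem aemeasurable_chart_symm (c : M) :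
    AEMeasurable (chartAt (Model n) c).symm
      (volume.restrict (chartAt (Model n) c).target) :=
  (chartAt (Model n) c).continuousOn_symm.aemeasurable
    (chartAt (Model n) c).open_target.measurableSet

theorem aemeasurable_chart_symm_withDensity (c : M) (w : Model n → ENNReal) :
    AEMeasurable (chartAt (Model n) c).symm
      ((volume.restrict (chartAt (Model n) c).target).withDensity w) :=
  (aemeasurable_chart_symm c).mono_ac (withDensity_absolutelyContinuous _ _)

variable [RiemannianBundle (fun x : M => TangentSpace (𝓡 n) x)]

theorem chartVolume_apply (c : M) {s : Set M} (hs : MeasurableSet s) :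
    chartVolume (n := n) c s =
      ∫⁻ p in chartAt (Model n) c '' (s ∩ (chartAt (Model n) c).source),
        ENNReal.ofReal (volDensity c p) := by
  rw [chartVolume, Measure.map_apply_of_aemeasurable
    (aemeasurable_chart_symm_withDensity c _) hs, withDensity_apply',
    Measure.restrict_restrict₀ ((aemeasurable_chart_symm c).nullMeasurableSet_preimage hs)]
  congr 2
  rw [inter_comm s, (chartAt (Model n) c).image_source_inter_eq', inter_comm]

theorem chartVolume_compl_source (c : M) :
    chartVolume (n := n) c (chartAt (Model n) c).sourceᶜ = 0 := by
  rw [chartVolume_apply c (chartAt (Model n) c).open_source.measurableSet.compl]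
  simp

variable [IsManifold (𝓡 n) ∞ M]

/-- This is the change of variables formula for the transition map: its Jacobian factor is exactly
the ratio of densities in `volDensity_change`. -/
theorem chartVolume_eq_of_subset {c d : M} {s : Set M} (hs : MeasurableSet s)
    (hc : s ⊆ (chartAt (Model n) c).source) (hd : s ⊆ (chartAt (Model n) d).source) :
    chartVolume (n := n) c s = chartVolume (n := n) d s := by
  rw [chartVolume_apply c hs, chartVolume_apply d hs, inter_eq_left.2 hc, inter_eq_left.2 hd]
  set S := chartAt (Model n) c '' s
  have hS : MeasurableSet S := by
    have h := (chartAt (Model n) c).image_source_inter_eq' s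
    rw [inter_eq_right.2 hc] at h
    change MeasurableSet (chartAt (Model n) c '' s)
    rw [h]
    have h1 := (continuousOn_iff_continuous_domRestrict.1
      (chartAt (Model n) c).continuousOn_symm).measurable hs
    have h2 := (chartAt (Model n) c).open_target.measurableSet.subtype_image h1
    convert h2 using 1
    ext p
    simp [and_comm]
  have himg : chartAt (Model n) d '' s =
      (chartAt (Model n) d ∘ (chartAt (Model n) c).symm) '' S := by
    simp only [S, image_image, Function.comp_apply]
    exact image_congr fun x hx => by rw [(chartAt (Model n) c).left_inv (hc hx)]
  rw [himg, lintegral_image_eq_lintegral_abs_det_fderiv_mul volume hS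
    (f' := fun p => jac c d p)]
  · refine setLIntegral_congr_fun hS ?_
    rintro _ ⟨x, hx, rfl⟩
    simp only [Function.comp_apply, (chartAt (Model n) c).left_inv (hc hx)]
    rw [volDensity_change (hc hx) (hd hx), ENNReal.ofReal_mul (abs_nonneg _)]
  · rintro _ ⟨x, hx, rfl⟩
    exact (hasFDerivAt_chart_change (hc hx) (hd hx)).hasFDerivWithinAt
  · rintro _ ⟨x, hx, rfl⟩ _ ⟨y, hy, rfl⟩ h
    simp only [Function.comp_apply, (chartAt (Model n) c).left_inv (hc hx),
      (chartAt (Model n) c).left_inv (hc hy)] at h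
    rw [(chartAt (Model n) d).injOn (hd hx) (hd hy) h]

theorem chartVolume_restrict_le (c d : M) :
    (chartVolume (n := n) d).restrict (chartAt (Model n) c).source ≤ chartVolume (n := n) c := by
  have hmc := (chartAt (Model n) c).open_source.measurableSet
  have hmd := (chartAt (Model n) d).open_source.measurableSet
  refine Measure.le_iff.2 fun s hs => ?_
  rw [Measure.restrict_apply hs, ← measure_inter_add_sdiff (μ := chartVolume (n := n) d) _ hmd]
  have h0 : chartVolume (n := n) d
      ((s ∩ (chartAt (Model n) c).source) \ (chartAt (Model n) d).source) = 0 :=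
    measure_mono_null (fun x hx => hx.2) (chartVolume_compl_source d)
  rw [h0, add_zero, ← chartVolume_eq_of_subset (c := c) ((hs.inter hmc).inter hmd)
    (fun x hx => hx.1.2) (fun x hx => hx.2)]
  exact measure_mono fun x hx => hx.1.1

/-- The Riemannian volume restricts to `chartVolume c` on the domain of the chart at `c`. -/
theorem riemannianVolume_restrict_source (c : M) :
    (riemannianVolume n M).restrict (chartAt (Model n) c).source = chartVolume (n := n) c := by
  have hmc := (chartAt (Model n) c).open_source.measurableSet
  have hself : (chartVolume (n := n) c).restrict (chartAt (Model n) c).source =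
      chartVolume (n := n) c :=
    Measure.restrict_eq_self_of_ae_mem (by
      rw [ae_iff]; exact chartVolume_compl_source c)
  apply le_antisymm
  -- Each member of the supremum is at most `chartVolume c` inside the chart domain; outside it the
  -- crude bound `⊤` is harmless, because restriction to the domain removes it.
  · have h : riemannianVolume n M ≤
        chartVolume (n := n) c + (⊤ : Measure M).restrict (chartAt (Model n) c).sourceᶜ := by
      refine iSup_le fun d => ?_
      rw [← Measure.restrict_add_restrict_compl (μ := chartVolume (n := n) d) hmc]
      exact add_le_add (chartVolume_restrict_le c d) (Measure.restrict_mono le_rfl le_top)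
    refine (Measure.restrict_mono le_rfl h).trans ?_
    rw [Measure.restrict_add, hself, Measure.restrict_restrict hmc, inter_compl_self,
      Measure.restrict_empty, add_zero]
  · rw [← hself]
    exact Measure.restrict_mono le_rfl (le_iSup (fun d : M => chartVolume (n := n) d) c)

end Volume

/-! ### Null sets and integrals of the Riemannian volume in a chart. -/

section VolumeIntegral

variable [IsManifold (𝓡 n) ∞ M] [RiemannianBundle (fun x : M => TangentSpace (𝓡 n) x)]
  [MeasurableSpace M] [BorelSpace M]

theorem riemannianVolume_of_subset_source {c : M} {s : Set M} (hs : MeasurableSet s)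
    (hc : s ⊆ (chartAt (Model n) c).source) :
    riemannianVolume n M s =
      ∫⁻ p in chartAt (Model n) c '' s, ENNReal.ofReal (volDensity c p) := by
  rw [← Measure.restrict_eq_self _ hc, riemannianVolume_restrict_source, chartVolume_apply c hs,
    inter_eq_left.2 hc]

/-- The density is positive on the chart target, so null sets of the volume are null for Lebesgue
measure in coordinates. -/
theorem ae_chart_symm_of_ae {c : M} {Q : M → Prop}
    [IsContMDiffRiemannianBundle (𝓡 n) ∞ (Model n) (fun x : M => TangentSpace (𝓡 n) x)]
    (h : ∀ᵐ x ∂(riemannianVolume n M), x ∈ (chartAt (Model n) c).source → Q x) :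
    ∀ᵐ p ∂(volume : Measure (Model n)), p ∈ (chartAt (Model n) c).target →
      Q ((chartAt (Model n) c).symm p) := by
  have hms := (chartAt (Model n) c).open_source.measurableSet
  have hmt := (chartAt (Model n) c).open_target.measurableSet
  rw [← ae_restrict_iff' hms, riemannianVolume_restrict_source, chartVolume] at h
  have h1 := ae_of_ae_map (aemeasurable_chart_symm_withDensity c _) h
  rw [ae_withDensity_iff' (aemeasurable_volDensity c), ae_restrict_iff' hmt] at h1
  filter_upwards [h1] with p hp hpt
  exact hp hpt (ENNReal.ofReal_pos.2 (volDensity_pos hpt)).ne'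

theorem ae_chart_of_ae {c : M} {Q : Model n → Prop}
    (h : ∀ᵐ p ∂(volume : Measure (Model n)), Q p) :
    ∀ᵐ x ∂(riemannianVolume n M), x ∈ (chartAt (Model n) c).source →
      Q (chartAt (Model n) c x) := by
  have hms := (chartAt (Model n) c).open_source.measurableSet
  obtain ⟨t, hts, htm, ht0⟩ := exists_measurable_superset_of_null (ae_iff.1 h)
  rw [ae_iff]
  have hm : MeasurableSet ((chartAt (Model n) c).source ∩ chartAt (Model n) c ⁻¹' t) := by
    have h1 := (continuousOn_iff_continuous_domRestrict.1
      (chartAt (Model n) c).continuousOn).measurable htm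
    have h2 := hms.subtype_image h1
    convert h2 using 1
    ext p
    simp [and_comm]
  refine measure_mono_null
    (t := (chartAt (Model n) c).source ∩ chartAt (Model n) c ⁻¹' t) ?_ ?_
  · intro x hx
    simp only [mem_ofPred_eq, Classical.not_imp] at hx
    exact ⟨hx.1, hts hx.2⟩
  · rw [riemannianVolume_of_subset_source hm inter_subset_left]
    refine setLIntegral_measure_zero _ _ (measure_mono_null ?_ ht0)
    rintro _ ⟨x, hx, rfl⟩
    exact hx.2

variable [IsContMDiffRiemannianBundle (𝓡 n) ∞ (Model n) (fun x : M => TangentSpace (𝓡 n) x)]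

theorem integral_eq_chart {c : M} {f : M → ℝ}
    (hf : AEStronglyMeasurable f (riemannianVolume n M))
    (h0 : ∀ x ∉ (chartAt (Model n) c).source, f x = 0) :
    ∫ x, f x ∂(riemannianVolume n M) =
      ∫ p in (chartAt (Model n) c).target, volDensity c p * f ((chartAt (Model n) c).symm p) := by
  have hmt := (chartAt (Model n) c).open_target.measurableSet
  rw [← setIntegral_eq_integral_of_forall_compl_eq_zero h0]
  have hf' := hf.restrict (s := (chartAt (Model n) c).source)
  rw [riemannianVolume_restrict_source] at hf' ⊢
  rw [chartVolume] at hf' ⊢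
  rw [integral_map (aemeasurable_chart_symm_withDensity c _) hf',
    integral_withDensity_eq_integral_toReal_smul₀ (aemeasurable_volDensity c)
      (by simp)]
  refine setIntegral_congr_fun hmt fun p hp => ?_
  simp only [smul_eq_mul]
  rw [ENNReal.toReal_ofReal (volDensity_pos hp).le]

theorem integrableOn_chart {c : M} {f : M → ℝ} (hf : Integrable f (riemannianVolume n M)) :
    IntegrableOn (fun p => volDensity c p * f ((chartAt (Model n) c).symm p))
      (chartAt (Model n) c).target := by
  have hmt := (chartAt (Model n) c).open_target.measurableSet
  have hf' := hf.restrict (s := (chartAt (Model n) c).source)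
  rw [riemannianVolume_restrict_source, chartVolume] at hf'
  have h1 := hf'.comp_aemeasurable (aemeasurable_chart_symm_withDensity c _)
  rw [integrable_withDensity_iff_integrable_smul₀' (aemeasurable_volDensity c) (by simp)] at h1
  refine h1.congr ?_
  filter_upwards [ae_restrict_mem hmt] with p hp
  simp [ENNReal.toReal_ofReal (volDensity_pos hp).le]

instance : IsLocallyFiniteMeasure (riemannianVolume n M) := by
  refine ⟨fun x => ?_⟩
  have hx := mem_chart_source (Model n) x
  have hx' := mem_chart_target (Model n) x
  have hc := (continuousOn_volDensity x).continuousAt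
    ((chartAt (Model n) x).open_target.mem_nhds hx')
  obtain ⟨r, hr, hr2⟩ := Metric.nhds_basis_closedBall.mem_iff.1
    ((chartAt (Model n) x).open_target.mem_nhds hx')
  have ho : IsOpen ((chartAt (Model n) x).source ∩
      chartAt (Model n) x ⁻¹' Metric.ball (chartAt (Model n) x x) r) :=
    (chartAt (Model n) x).isOpen_inter_preimage Metric.isOpen_ball
  refine ⟨_, ho.mem_nhds ⟨hx, Metric.mem_ball_self hr⟩, ?_⟩
  rw [riemannianVolume_of_subset_source ho.measurableSet inter_subset_left]
  have hint : IntegrableOn (volDensity (n := n) x) (Metric.closedBall (chartAt (Model n) x x) r) :=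
    ((continuousOn_volDensity x).mono hr2).integrableOn_compact (isCompact_closedBall _ _)
  refine lt_of_le_of_lt (lintegral_mono_set (t := Metric.closedBall (chartAt (Model n) x x) r) ?_)
    hint.lintegral_lt_top
  rintro _ ⟨y, hy, rfl⟩
  exact Metric.ball_subset_closedBall hy.2

/-- Positivity on open sets turns almost everywhere equality of continuous functions into equality,
which is how the chart independence of the divergence is obtained. -/
instance : (riemannianVolume n M).IsOpenPosMeasure := by
  refine ⟨fun U hU hne h0 => ?_⟩
  obtain ⟨x, hxU⟩ := hne
  have hx := mem_chart_source (Model n) x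
  have ho : IsOpen (U ∩ (chartAt (Model n) x).source) :=
    hU.inter (chartAt (Model n) x).open_source
  have h1 : riemannianVolume n M (U ∩ (chartAt (Model n) x).source) = 0 :=
    measure_mono_null inter_subset_left h0
  rw [riemannianVolume_of_subset_source ho.measurableSet inter_subset_right] at h1
  have hoi : IsOpen (chartAt (Model n) x '' (U ∩ (chartAt (Model n) x).source)) := by
    rw [inter_comm]
    exact (chartAt (Model n) x).isOpen_image_source_inter hU
  have hsub : chartAt (Model n) x '' (U ∩ (chartAt (Model n) x).source) ⊆
      (chartAt (Model n) x).target := by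
    rintro _ ⟨y, hy, rfl⟩
    exact (chartAt (Model n) x).map_source hy.2
  have hae := (lintegral_eq_zero_iff'
    ((aemeasurable_volDensity x).mono_measure (Measure.restrict_mono hsub le_rfl))).1 h1
  rw [Filter.EventuallyEq, ae_restrict_iff' hoi.measurableSet, ae_iff] at hae
  refine (hoi.measure_pos volume ⟨_, mem_image_of_mem _ ⟨hxU, hx⟩⟩).ne'
    (measure_mono_null (fun p hp => ?_) hae)
  simp only [mem_ofPred_eq, Classical.not_imp]
  exact ⟨hp, (ENNReal.ofReal_pos.2 (volDensity_pos (hsub hp))).ne'⟩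

end VolumeIntegral

/-! ### Products and extensions by zero of compactly supported objects. -/

section Extension

/-- Off the support of `f` the product vanishes locally, so `g` may be arbitrary there. This is used
for factors that are regular only on a chart domain or only where ρ ≠ 0, such as C/ρ. -/
theorem continuous_mul_of_tsupport {Y : Type*} [TopologicalSpace Y] {f g : Y → ℝ} {U : Set Y}
    (hf : Continuous f) (hU : tsupport f ⊆ U) (hg : ∀ x ∈ U, ContinuousAt g x) :
    Continuous fun x => f x * g x := by
  refine continuous_iff_continuousAt.2 fun x => ?_
  by_cases hx : x ∈ tsupport f
  · exact hf.continuousAt.mul (hg x (hU hx))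
  · refine (continuousAt_const (y := (0 : ℝ))).congr ?_
    filter_upwards [notMem_tsupport_iff_eventuallyEq.1 hx] with y hy
    simp [hy]

theorem integral_mul_fderiv_of_tsupport {F g : Model n → ℝ} {T : Set (Model n)}
    (hF : ContDiff ℝ ∞ F) (hFc : HasCompactSupport F) (hFT : tsupport F ⊆ T)
    (hg : ∀ p ∈ T, ContDiffAt ℝ ∞ g p) (v : Model n) :
    Integrable (fun p => F p * fderiv ℝ g p v) ∧ Integrable (fun p => fderiv ℝ F p v * g p) ∧
    ∫ p, F p * fderiv ℝ g p v = - ∫ p, fderiv ℝ F p v * g p := by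
  have hdF : Continuous fun p => fderiv ℝ F p v :=
    (hF.continuous_fderiv (by simp)).clm_apply continuous_const
  have hsupp : tsupport (fun p => fderiv ℝ F p v) ⊆ tsupport F :=
    tsupport_fderiv_apply_subset ℝ v
  have hdFc : HasCompactSupport fun p => fderiv ℝ F p v := hFc.fderiv_apply ℝ v
  have hdg : ∀ p ∈ T, ContinuousAt (fun q => fderiv ℝ g q v) p := fun p hp =>
    (((hg p hp).fderiv_right (m := 0) (by simp)).continuousAt).clm_apply continuousAt_const
  have h1 : Integrable fun p => F p * fderiv ℝ g p v :=
    (continuous_mul_of_tsupport hF.continuous hFT hdg).integrable_of_hasCompactSupport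
      hFc.mul_right
  have h2 : Integrable fun p => fderiv ℝ F p v * g p :=
    (continuous_mul_of_tsupport hdF (hsupp.trans hFT)
      fun p hp => (hg p hp).continuousAt).integrable_of_hasCompactSupport hdFc.mul_right
  have h3 : Integrable fun p => F p * g p :=
    (continuous_mul_of_tsupport hF.continuous hFT
      fun p hp => (hg p hp).continuousAt).integrable_of_hasCompactSupport hFc.mul_right
  exact ⟨h1, h2, integral_mul_fderiv_eq_neg_fderiv_mul_of_integrable h2 h1 h3
    (fun p _ => hF.differentiable (by simp) p)
    fun p hp => (hg p (hFT hp)).differentiableAt (by simp)⟩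

/-- A function on `M` read in the chart at `c` and extended by zero. -/
def toChart (c : M) (f : M → ℝ) : Model n → ℝ :=
  (chartAt (Model n) c).target.indicator (f ∘ (chartAt (Model n) c).symm)

/-- A function of the coordinates of the chart at `c`, extended by zero to `M`. -/
def ofChart (c : M) (F : Model n → ℝ) : M → ℝ :=
  (chartAt (Model n) c).source.indicator (F ∘ chartAt (Model n) c)

theorem tsupport_toChart {c : M} {f : M → ℝ} (hfc : HasCompactSupport f)
    (hfs : tsupport f ⊆ (chartAt (Model n) c).source) :
    IsCompact (chartAt (Model n) c '' tsupport f) ∧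
      tsupport (toChart c f) ⊆ chartAt (Model n) c '' tsupport f := by
  have hK : IsCompact (chartAt (Model n) c '' tsupport f) :=
    IsCompact.image_of_continuousOn hfc ((chartAt (Model n) c).continuousOn.mono hfs)
  refine ⟨hK, closure_minimal (fun p hp => ?_) hK.isClosed⟩
  have hpT : p ∈ (chartAt (Model n) c).target := by
    by_contra h
    exact hp (indicator_of_notMem h _)
  have h : f ((chartAt (Model n) c).symm p) ≠ 0 := by
    simpa [toChart, hpT] using hp
  exact ⟨_, subset_tsupport f h, (chartAt (Model n) c).right_inv hpT⟩

theorem toChart_eventuallyEq {c : M} (f : M → ℝ) {p : Model n}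
    (hp : p ∈ (chartAt (Model n) c).target) :
    toChart c f =ᶠ[𝓝 p] f ∘ (chartAt (Model n) c).symm := by
  filter_upwards [(chartAt (Model n) c).open_target.mem_nhds hp] with q hq
  exact indicator_of_mem hq _

theorem tsupport_ofChart [T2Space M] {c : M} {F : Model n → ℝ} (hFc : HasCompactSupport F)
    (hFs : tsupport F ⊆ (chartAt (Model n) c).target) :
    IsCompact ((chartAt (Model n) c).symm '' tsupport F) ∧
      tsupport (ofChart c F) ⊆ (chartAt (Model n) c).symm '' tsupport F := by
  have hK : IsCompact ((chartAt (Model n) c).symm '' tsupport F) :=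
    IsCompact.image_of_continuousOn hFc ((chartAt (Model n) c).continuousOn_symm.mono hFs)
  refine ⟨hK, closure_minimal (fun x hx => ?_) hK.isClosed⟩
  have hxS : x ∈ (chartAt (Model n) c).source := by
    by_contra h
    exact hx (indicator_of_notMem h _)
  have h : F (chartAt (Model n) c x) ≠ 0 := by
    simpa [ofChart, hxS] using hx
  exact ⟨_, subset_tsupport F h, (chartAt (Model n) c).left_inv hxS⟩

theorem contMDiff_mul_of_tsupport {f g : M → ℝ} {U : Set M}
    (hf : ContMDiff (𝓡 n) 𝓘(ℝ, ℝ) ∞ f) (hU : tsupport f ⊆ U)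
    (hg : ∀ x ∈ U, ContMDiffAt (𝓡 n) 𝓘(ℝ, ℝ) ∞ g x) :
    ContMDiff (𝓡 n) 𝓘(ℝ, ℝ) ∞ fun x => f x * g x := by
  intro x
  by_cases hx : x ∈ tsupport f
  · exact hf.contMDiffAt.mul (hg x (hU hx))
  · refine (contMDiffAt_const (c := (0 : ℝ))).congr_of_eventuallyEq ?_
    filter_upwards [notMem_tsupport_iff_eventuallyEq.1 hx] with y hy
    simp [hy]

theorem mvfderiv_of_notMem_tsupport {f : M → ℝ} {x : M} (hx : x ∉ tsupport f) :
    mvfderiv (𝓡 n) f x = 0 := by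
  rw [mvfderiv, (notMem_tsupport_iff_eventuallyEq.1 hx).mfderiv_eq]
  exact mvfderiv_zero

theorem hasCompactSupport_mvfderiv [T2Space M] {f : M → ℝ} (hfc : HasCompactSupport f)
    (X : ∀ x : M, TangentSpace (𝓡 n) x) :
    HasCompactSupport fun x => mvfderiv (𝓡 n) f x (X x) := by
  refine HasCompactSupport.of_support_subset_isCompact hfc fun x hx => ?_
  by_contra h
  refine hx ?_
  simp only [mvfderiv_of_notMem_tsupport h]
  rfl

variable [IsManifold (𝓡 n) ∞ M]

theorem contDiffAt_toChart {c : M} {f : M → ℝ} (hf : ContMDiff (𝓡 n) 𝓘(ℝ, ℝ) ∞ f) {p : Model n}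
    (hp : p ∈ (chartAt (Model n) c).target) :
    ContDiffAt ℝ ∞ (f ∘ (chartAt (Model n) c).symm) p := by
  have h := contDiffAt_comp_chart_symm ((chartAt (Model n) c).map_target hp) (hf.contMDiffAt)
  rwa [(chartAt (Model n) c).right_inv hp] at h

theorem contDiff_toChart {c : M} {f : M → ℝ} (hf : ContMDiff (𝓡 n) 𝓘(ℝ, ℝ) ∞ f)
    (hfc : HasCompactSupport f) (hfs : tsupport f ⊆ (chartAt (Model n) c).source) :
    ContDiff ℝ ∞ (toChart (n := n) c f) := by
  refine contDiff_iff_contDiffAt.2 fun p => ?_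
  by_cases hp : p ∈ (chartAt (Model n) c).target
  · exact (contDiffAt_toChart hf hp).congr_of_eventuallyEq (toChart_eventuallyEq f hp)
  · have hp' : p ∉ tsupport (toChart c f) := fun h => by
      obtain ⟨y, hy, rfl⟩ := (tsupport_toChart hfc hfs).2 h
      exact hp ((chartAt (Model n) c).map_source (hfs hy))
    exact (contDiffAt_const (c := (0 : ℝ))).congr_of_eventuallyEq
      (notMem_tsupport_iff_eventuallyEq.1 hp')

theorem contMDiff_ofChart [T2Space M] {c : M} {F : Model n → ℝ} (hF : ContDiff ℝ ∞ F)
    (hFc : HasCompactSupport F) (hFs : tsupport F ⊆ (chartAt (Model n) c).target) :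
    ContMDiff (𝓡 n) 𝓘(ℝ, ℝ) ∞ (ofChart c F) := by
  intro x
  by_cases hx : x ∈ (chartAt (Model n) c).source
  · refine (contMDiffAt_comp_chart hx hF.contDiffAt).congr_of_eventuallyEq ?_
    filter_upwards [(chartAt (Model n) c).open_source.mem_nhds hx] with y hy
    exact indicator_of_mem hy _
  · have hx' : x ∉ tsupport (ofChart c F) := fun h => by
      obtain ⟨y, hy, rfl⟩ := (tsupport_ofChart hFc hFs).2 h
      exact hx ((chartAt (Model n) c).map_target (hFs hy))
    exact (contMDiffAt_const (c := (0 : ℝ))).congr_of_eventuallyEq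
      (notMem_tsupport_iff_eventuallyEq.1 hx')

/-- Smoothness of a vector field. -/
def IsSmoothField (X : ∀ x : M, TangentSpace (𝓡 n) x) : Prop :=
  ContMDiff (𝓡 n) (𝓡 n).tangent ∞ (fun x => (⟨x, X x⟩ : TangentBundle (𝓡 n) M))

theorem isSmoothField_smul_of_tsupport {f : M → ℝ} {U : Set M}
    {X : ∀ x : M, TangentSpace (𝓡 n) x}
    (hf : ContMDiff (𝓡 n) 𝓘(ℝ, ℝ) ∞ f) (hU : tsupport f ⊆ U)
    (hX : ∀ x ∈ U, ContMDiffAt (𝓡 n) (𝓡 n).tangent ∞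
      (fun y => (⟨y, X y⟩ : TangentBundle (𝓡 n) M)) x) :
    IsSmoothField fun x => f x • X x := by
  intro x
  have hx := mem_chart_source (Model n) x
  rw [contMDiffAt_coords_iff hx]
  by_cases hxs : x ∈ tsupport f
  · have h := (contMDiffAt_coords_iff hx).1 (hX x (hU hxs))
    have h2 := (hf.contMDiffAt (x := x)).smul h
    refine h2.congr_of_eventuallyEq (Filter.Eventually.of_forall fun y => ?_)
    simp
  · refine (contMDiffAt_const (c := (0 : Model n))).congr_of_eventuallyEq ?_
    filter_upwards [notMem_tsupport_iff_eventuallyEq.1 hxs] with y hy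
    simp [hy]

theorem IsSmoothField.smul {f : M → ℝ} {X : ∀ x : M, TangentSpace (𝓡 n) x}
    (hX : IsSmoothField X) (hf : ContMDiff (𝓡 n) 𝓘(ℝ, ℝ) ∞ f) :
    IsSmoothField fun x => f x • X x :=
  isSmoothField_smul_of_tsupport hf (subset_univ _) fun x _ => hX x

variable {X : ∀ x : M, TangentSpace (𝓡 n) x} {c x : M}

theorem IsSmoothField.contDiffAt_coordComp (hX : IsSmoothField X) {p : Model n}
    (hp : p ∈ (chartAt (Model n) c).target) (i : Fin n) :
    ContDiffAt ℝ ∞ (fun q => coordComp c X q i) p := by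
  have hx := (chartAt (Model n) c).map_target hp
  have h1 := (contMDiffAt_coords_iff hx).1 (hX _)
  have h2 : ContMDiffAt (𝓡 n) 𝓘(ℝ, ℝ) ∞ (fun y => coords c y (X y) i)
      ((chartAt (Model n) c).symm p) :=
    (EuclideanSpace.proj (𝕜 := ℝ) i : Model n →L[ℝ] ℝ).contMDiff.contMDiffAt.comp _ h1
  have h3 := contDiffAt_comp_chart_symm hx h2
  rw [(chartAt (Model n) c).right_inv hp] at h3
  apply h3.congr_of_eventuallyEq
  filter_upwards [(chartAt (Model n) c).open_target.mem_nhds hp] with q hq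
  exact coordComp_eq_coords X hq i

theorem mvfderiv_eq_sum (hx : x ∈ (chartAt (Model n) c).source) {f : M → ℝ}
    (hf : MDifferentiableAt (𝓡 n) 𝓘(ℝ, ℝ) f x) (v : TangentSpace (𝓡 n) x) :
    mvfderiv (𝓡 n) f x v = ∑ i : Fin n, coords c x v i *
      fderiv ℝ (f ∘ (chartAt (Model n) c).symm) (chartAt (Model n) c x)
        (EuclideanSpace.single i 1) := by
  conv_lhs => rw [← vec_coords hx v, mvfderiv_vec hx hf, model_eq_sum (coords c x v), map_sum]
  simp

theorem mvfderiv_field_eq_sum (hx : x ∈ (chartAt (Model n) c).source) {f : M → ℝ}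
    (hf : MDifferentiableAt (𝓡 n) 𝓘(ℝ, ℝ) f x) (X : ∀ x : M, TangentSpace (𝓡 n) x) :
    mvfderiv (𝓡 n) f x (X x) = ∑ i : Fin n, coordComp c X (chartAt (Model n) c x) i *
      fderiv ℝ (f ∘ (chartAt (Model n) c).symm) (chartAt (Model n) c x)
        (EuclideanSpace.single i 1) := by
  rw [mvfderiv_eq_sum hx hf]
  refine Finset.sum_congr rfl fun i _ => ?_
  rw [coordComp_eq_coords X ((chartAt (Model n) c).map_source hx), (chartAt (Model n) c).left_inv hx]

theorem IsSmoothField.contMDiff_mvfderiv (hX : IsSmoothField X) {f : M → ℝ}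
    (hf : ContMDiff (𝓡 n) 𝓘(ℝ, ℝ) ∞ f) :
    ContMDiff (𝓡 n) 𝓘(ℝ, ℝ) ∞ fun x => mvfderiv (𝓡 n) f x (X x) := by
  intro x
  have hx := mem_chart_source (Model n) x
  have hx' := mem_chart_target (Model n) x
  have h : ContDiffAt ℝ ∞ (fun p => ∑ i : Fin n, coordComp x X p i *
      fderiv ℝ (f ∘ (chartAt (Model n) x).symm) p (EuclideanSpace.single i 1))
      (chartAt (Model n) x x) := by
    refine ContDiffAt.sum fun i _ => (hX.contDiffAt_coordComp hx' i).mul ?_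
    exact ((contDiffAt_toChart hf hx').fderiv_right (m := ∞) (by simp)).clm_apply contDiffAt_const
  refine (contMDiffAt_comp_chart hx h).congr_of_eventuallyEq ?_
  filter_upwards [(chartAt (Model n) x).open_source.mem_nhds hx] with y hy
  exact mvfderiv_field_eq_sum hy (hf.mdifferentiableAt (by simp)) X

end Extension

/-! ### Chart independence of the divergence and integration by parts. -/

section Divergence

variable [IsManifold (𝓡 n) ∞ M]

theorem sigmaCompactSpace_of_chartedSpace (n : ℕ) (M : Type*) [TopologicalSpace M]
    [ChartedSpace (Model n) M] [SecondCountableTopology M] : SigmaCompactSpace M :=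
  have := ChartedSpace.locallyCompactSpace (Model n) M
  inferInstance

/-- Additive properties of `f` follow from those of the functions `χ f` with `χ ≥ 0` supported in
a chart domain. -/
theorem induction_on_charts [T2Space M] [SecondCountableTopology M] {f : M → ℝ}
    (hfc : HasCompactSupport f) {P : (M → ℝ) → Prop} (h0 : P 0)
    (hadd : ∀ g h, P g → P h → P (g + h))
    (hloc : ∀ (c : M) (χ : M → ℝ), ContMDiff (𝓡 n) 𝓘(ℝ, ℝ) ∞ χ → (∀ x, 0 ≤ χ x) →
      tsupport χ ⊆ (chartAt (Model n) c).source → P (χ * f)) : P f := by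
  have := sigmaCompactSpace_of_chartedSpace n M
  classical
  obtain ⟨χ, hχ⟩ := SmoothPartitionOfUnity.exists_isSubordinate_chartAt_source (𝓡 n) M
  -- Only finitely many members of the partition meet the compact support of `f`, so `f` is a finite
  -- sum of the localised functions.
  have hfin := χ.locallyFinite.finite_nonempty_inter_compact hfc
  have hP : ∀ s : Finset M, P (∑ c ∈ s, (χ c : M → ℝ) * f) := by
    intro s
    induction s using Finset.induction_on with
    | empty => simpa using h0
    | insert c s hc ih =>
      rw [Finset.sum_insert hc]
      exact hadd _ _ (hloc c _ (χ c).contMDiff (χ.nonneg c) (hχ c)) ih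
  convert hP hfin.toFinset using 1
  ext x
  rw [Finset.sum_apply]
  simp only [Pi.mul_apply]
  rw [← Finset.sum_mul]
  by_cases hx : x ∈ tsupport f
  · have h1 := χ.sum_eq_one (mem_univ x)
    rw [finsum_eq_sum_of_support_subset (s := hfin.toFinset)] at h1
    · rw [h1, one_mul]
    · intro c hc
      simpa using ⟨x, hc, hx⟩
  · rw [image_eq_zero_of_notMem_tsupport hx, mul_zero]

variable [RiemannianBundle (fun x : M => TangentSpace (𝓡 n) x)]

/-- The divergence computed in the chart at `c`. -/
def divC (c : M) (X : ∀ x : M, TangentSpace (𝓡 n) x) (x : M) : ℝ :=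
  (volDensity c (chartAt (Model n) c x))⁻¹ *
    ∑ i : Fin n, fderiv ℝ (fun p : Model n => volDensity c p * coordComp c X p i)
      (chartAt (Model n) c x) (EuclideanSpace.single i (1 : ℝ))

variable [IsContMDiffRiemannianBundle (𝓡 n) ∞ (Model n) (fun x : M => TangentSpace (𝓡 n) x)]
variable {X : ∀ x : M, TangentSpace (𝓡 n) x} {c x : M}

theorem IsSmoothField.contDiffAt_density_mul (hX : IsSmoothField X) {p : Model n}
    (hp : p ∈ (chartAt (Model n) c).target) (i : Fin n) :
    ContDiffAt ℝ ∞ (fun p : Model n => volDensity c p * coordComp c X p i) p :=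
  (contDiffAt_volDensity hp).mul (hX.contDiffAt_coordComp hp i)

theorem IsSmoothField.contMDiffAt_divC (hX : IsSmoothField X)
    (hx : x ∈ (chartAt (Model n) c).source) :
    ContMDiffAt (𝓡 n) 𝓘(ℝ, ℝ) ∞ (divC c X) x := by
  have hx' := (chartAt (Model n) c).map_source hx
  have h : ContDiffAt ℝ ∞ (fun q => (volDensity c q)⁻¹ *
      ∑ i : Fin n, fderiv ℝ (fun p : Model n => volDensity c p * coordComp c X p i)
      q (EuclideanSpace.single i (1 : ℝ))) (chartAt (Model n) c x) := by
    refine ((contDiffAt_volDensity hx').inv (volDensity_pos hx').ne').mul ?_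
    refine ContDiffAt.sum fun i _ => ?_
    exact ((hX.contDiffAt_density_mul hx' i).fderiv_right (m := ∞) (by simp)).clm_apply
      contDiffAt_const
  exact contMDiffAt_comp_chart hx h

theorem divC_smul (hX : IsSmoothField X) {f : M → ℝ} (hf : ContMDiff (𝓡 n) 𝓘(ℝ, ℝ) ∞ f)
    (hx : x ∈ (chartAt (Model n) c).source) :
    divC c (fun y => f y • X y) x = f x * divC c X x + mvfderiv (𝓡 n) f x (X x) := by
  have hx' := (chartAt (Model n) c).map_source hx
  have hv := (volDensity_pos hx').ne'
  rw [mvfderiv_field_eq_sum hx (hf.mdifferentiableAt (by simp)) X, divC, divC]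
  have h1 : ∀ i : Fin n, fderiv ℝ
      (fun p : Model n => volDensity c p * coordComp c (fun y => f y • X y) p i)
      (chartAt (Model n) c x) (EuclideanSpace.single i (1 : ℝ)) =
      f x * fderiv ℝ (fun p : Model n => volDensity c p * coordComp c X p i)
        (chartAt (Model n) c x) (EuclideanSpace.single i (1 : ℝ)) +
      volDensity c (chartAt (Model n) c x) * (coordComp c X (chartAt (Model n) c x) i *
        fderiv ℝ (f ∘ (chartAt (Model n) c).symm) (chartAt (Model n) c x)
          (EuclideanSpace.single i (1 : ℝ))) := by
    intro i
    have h2 : (fun p : Model n => volDensity c p * coordComp c (fun y => f y • X y) p i)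
        =ᶠ[𝓝 (chartAt (Model n) c x)]
        fun p => (f ∘ (chartAt (Model n) c).symm) p * (volDensity c p * coordComp c X p i) := by
      filter_upwards [(chartAt (Model n) c).open_target.mem_nhds hx'] with q hq
      rw [coordComp_eq_coords _ hq, coordComp_eq_coords _ hq]
      simp only [map_smul, PiLp.smul_apply, smul_eq_mul, Function.comp_apply]
      ring
    rw [h2.fderiv_eq, fderiv_fun_mul ((contDiffAt_toChart hf hx').differentiableAt (by simp))
      ((hX.contDiffAt_density_mul hx' i).differentiableAt (by simp))]
    simp only [Function.comp_apply, (chartAt (Model n) c).left_inv hx, smul_apply, add_apply,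
      smul_eq_mul]
    simp
    ring
  simp only [h1, Finset.sum_add_distrib, ← Finset.mul_sum]
  field_simp

variable [MeasurableSpace M] [BorelSpace M]

/-- In coordinates the volume density cancels the prefactor of `divC`, and what is left is Euclidean
integration by parts in each coordinate direction. -/
theorem integral_mul_divC (hX : IsSmoothField X) {f : M → ℝ}
    (hf : ContMDiff (𝓡 n) 𝓘(ℝ, ℝ) ∞ f) (hfc : HasCompactSupport f)
    (hfs : tsupport f ⊆ (chartAt (Model n) c).source) :
    ∫ x, f x * divC c X x ∂(riemannianVolume n M) =
      - ∫ x, mvfderiv (𝓡 n) f x (X x) ∂(riemannianVolume n M) := by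
  have hmt := (chartAt (Model n) c).open_target.measurableSet
  have hcont1 : Continuous fun x => f x * divC c X x :=
    continuous_mul_of_tsupport hf.continuous hfs fun x hx => (hX.contMDiffAt_divC hx).continuousAt
  have hcont2 := (hX.contMDiff_mvfderiv hf).continuous
  have hzero : ∀ x ∉ (chartAt (Model n) c).source, f x = 0 := fun x hx =>
    image_eq_zero_of_notMem_tsupport fun h => hx (hfs h)
  have hzero' : ∀ x ∉ (chartAt (Model n) c).source, mvfderiv (𝓡 n) f x (X x) = 0 := fun x hx => by
    rw [mvfderiv_of_notMem_tsupport fun h => hx (hfs h)]; rfl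
  have hF := contDiff_toChart hf hfc hfs
  obtain ⟨hK, hKs⟩ := tsupport_toChart hfc hfs
  have hFc : HasCompactSupport (toChart (n := n) c f) :=
    HasCompactSupport.of_support_subset_isCompact hK ((subset_tsupport _).trans hKs)
  have hFT : tsupport (toChart (n := n) c f) ⊆ (chartAt (Model n) c).target := by
    refine hKs.trans ?_
    rintro _ ⟨y, hy, rfl⟩
    exact (chartAt (Model n) c).map_source (hfs hy)
  have hparts := fun i : Fin n => integral_mul_fderiv_of_tsupport hF hFc hFT
    (fun p hp => hX.contDiffAt_density_mul (c := c) hp i) (EuclideanSpace.single i (1 : ℝ))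
  have hl : ∫ x, f x * divC c X x ∂(riemannianVolume n M) =
      ∫ p, ∑ i : Fin n, toChart c f p *
        fderiv ℝ (fun p : Model n => volDensity c p * coordComp c X p i) p
          (EuclideanSpace.single i (1 : ℝ)) := by
    rw [integral_eq_chart hcont1.aestronglyMeasurable
      (fun x hx => by rw [hzero x hx, zero_mul])]
    refine (setIntegral_congr_fun hmt fun p hp => ?_).trans
      (setIntegral_eq_integral_of_forall_compl_eq_zero fun p hp => ?_)
    · have := (volDensity_pos hp).ne'
      simp only [divC, (chartAt (Model n) c).right_inv hp, toChart, indicator_of_mem hp,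
        Function.comp_apply, ← Finset.mul_sum]
      field_simp
    · simp [toChart, indicator_of_notMem hp]
  have hr : ∫ x, mvfderiv (𝓡 n) f x (X x) ∂(riemannianVolume n M) =
      ∫ p, ∑ i : Fin n, fderiv ℝ (toChart (n := n) c f) p (EuclideanSpace.single i (1 : ℝ)) *
        (volDensity c p * coordComp c X p i) := by
    rw [integral_eq_chart hcont2.aestronglyMeasurable hzero']
    refine (setIntegral_congr_fun hmt fun p hp => ?_).trans
      (setIntegral_eq_integral_of_forall_compl_eq_zero fun p hp => ?_)
    · have hx := (chartAt (Model n) c).map_target hp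
      rw [mvfderiv_field_eq_sum hx (hf.mdifferentiableAt (by simp)) X,
        (chartAt (Model n) c).right_inv hp, Finset.mul_sum, (toChart_eventuallyEq f hp).fderiv_eq]
      exact Finset.sum_congr rfl fun i _ => by ring
    · have h0 : fderiv ℝ (toChart (n := n) c f) p = 0 :=
        image_eq_zero_of_notMem_tsupport fun h => hp (hFT (tsupport_fderiv_subset ℝ h))
      simp [h0]
  rw [hl, hr, integral_finsetSum _ fun i _ => (hparts i).1,
    integral_finsetSum _ fun i _ => (hparts i).2.1, ← Finset.sum_neg_distrib]
  exact Finset.sum_congr rfl fun i _ => (hparts i).2.2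

variable [T2Space M] [SecondCountableTopology M]

/-- By `integral_mul_divC` both functions have the same integral against every test function
supported in the overlap, since the right side there does not involve the chart. They are
continuous, hence equal; no derivative of a transition map's Jacobian has to be computed. -/
theorem divC_eq_divC (hX : IsSmoothField X) {c d x : M} (hc : x ∈ (chartAt (Model n) c).source)
    (hd : x ∈ (chartAt (Model n) d).source) : divC c X x = divC d X x := by
  have := sigmaCompactSpace_of_chartedSpace n M
  set U := (chartAt (Model n) c).source ∩ (chartAt (Model n) d).source
  have hU : IsOpen U := (chartAt (Model n) c).open_source.inter (chartAt (Model n) d).open_source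
  have hcc : ContinuousOn (divC c X) U := fun y hy =>
    (hX.contMDiffAt_divC hy.1).continuousAt.continuousWithinAt
  have hcd : ContinuousOn (divC d X) U := fun y hy =>
    (hX.contMDiffAt_divC hy.2).continuousAt.continuousWithinAt
  have hae : ∀ᵐ y ∂(riemannianVolume n M), y ∈ U → divC c X y - divC d X y = 0 := by
    refine hU.ae_eq_zero_of_integral_contMDiff_smul_eq_zero (𝓡 n)
      ((hcc.sub hcd).locallyIntegrableOn hU.measurableSet) fun f hf hfc hfs => ?_
    have i1 : Integrable (fun y => f y * divC c X y) (riemannianVolume n M) :=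
      (continuous_mul_of_tsupport hf.continuous hfs fun y hy =>
        (hX.contMDiffAt_divC hy.1).continuousAt).integrable_of_hasCompactSupport hfc.mul_right
    have i2 : Integrable (fun y => f y * divC d X y) (riemannianVolume n M) :=
      (continuous_mul_of_tsupport hf.continuous hfs fun y hy =>
        (hX.contMDiffAt_divC hy.2).continuousAt).integrable_of_hasCompactSupport hfc.mul_right
    simp only [smul_eq_mul, mul_sub]
    rw [integral_sub i1 i2, integral_mul_divC hX hf hfc (hfs.trans inter_subset_left),
      integral_mul_divC hX hf hfc (hfs.trans inter_subset_right), sub_self]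
  have h2 : divC c X =ᵐ[(riemannianVolume n M).restrict U] divC d X := by
    rw [Filter.EventuallyEq, ae_restrict_iff' hU.measurableSet]
    filter_upwards [hae] with y hy hyU using sub_eq_zero.1 (hy hyU)
  exact Measure.eqOn_open_of_ae_eq h2 hU hcc hcd ⟨hc, hd⟩

theorem divergence_eq_divC (hX : IsSmoothField X) (hx : x ∈ (chartAt (Model n) c).source) :
    divergence X x = divC c X x :=
  divC_eq_divC hX (mem_chart_source (Model n) x) hx

theorem IsSmoothField.contMDiff_divergence (hX : IsSmoothField X) :
    ContMDiff (𝓡 n) 𝓘(ℝ, ℝ) ∞ (divergence X) := fun x => by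
  refine (hX.contMDiffAt_divC (mem_chart_source (Model n) x)).congr_of_eventuallyEq ?_
  filter_upwards [(chartAt (Model n) x).open_source.mem_nhds (mem_chart_source (Model n) x)]
    with y hy
  exact divergence_eq_divC hX hy

/-- Integration by parts on a Riemannian manifold. -/
theorem integral_mul_divergence (hX : IsSmoothField X) {f : M → ℝ}
    (hf : ContMDiff (𝓡 n) 𝓘(ℝ, ℝ) ∞ f) (hfc : HasCompactSupport f) :
    ∫ x, f x * divergence X x ∂(riemannianVolume n M) =
      - ∫ x, mvfderiv (𝓡 n) f x (X x) ∂(riemannianVolume n M) := by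
  -- Smoothness and compact support are carried through the induction because the additive step
  -- needs integrability of each summand.
  suffices h : ContMDiff (𝓡 n) 𝓘(ℝ, ℝ) ∞ f ∧ HasCompactSupport f ∧
      ∫ x, f x * divergence X x ∂(riemannianVolume n M) =
      - ∫ x, mvfderiv (𝓡 n) f x (X x) ∂(riemannianVolume n M) from h.2.2
  refine induction_on_charts (n := n) hfc (P := fun f => ContMDiff (𝓡 n) 𝓘(ℝ, ℝ) ∞ f ∧
    HasCompactSupport f ∧ ∫ x, f x * divergence X x ∂(riemannianVolume n M) =
      - ∫ x, mvfderiv (𝓡 n) f x (X x) ∂(riemannianVolume n M)) ?_ ?_ ?_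
  · refine ⟨contMDiff_const, HasCompactSupport.zero, ?_⟩
    simp [mvfderiv_zero]
  · rintro g h ⟨hg, hgc, hgi⟩ ⟨hh, hhc, hhi⟩
    refine ⟨hg.add hh, hgc.add hhc, ?_⟩
    have i (k : M → ℝ) (hk : ContMDiff (𝓡 n) 𝓘(ℝ, ℝ) ∞ k) (hkc : HasCompactSupport k) :
        Integrable (fun x => k x * divergence X x) (riemannianVolume n M) :=
      (hk.continuous.mul hX.contMDiff_divergence.continuous).integrable_of_hasCompactSupport
        hkc.mul_right
    have j (k : M → ℝ) (hk : ContMDiff (𝓡 n) 𝓘(ℝ, ℝ) ∞ k) (hkc : HasCompactSupport k) :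
        Integrable (fun x => mvfderiv (𝓡 n) k x (X x)) (riemannianVolume n M) :=
      (hX.contMDiff_mvfderiv hk).continuous.integrable_of_hasCompactSupport
        (hasCompactSupport_mvfderiv hkc X)
    have hd : ∀ x, mvfderiv (𝓡 n) (g + h) x (X x) =
        mvfderiv (𝓡 n) g x (X x) + mvfderiv (𝓡 n) h x (X x) := fun x => by
      rw [mvfderiv_add (hg.mdifferentiableAt (by simp)) (hh.mdifferentiableAt (by simp))]
      rfl
    simp only [hd, Pi.add_apply, add_mul]
    rw [integral_add (i g hg hgc) (i h hh hhc), integral_add (j g hg hgc) (j h hh hhc), hgi, hhi,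
      neg_add]
  · intro c χ hχ _ hχs
    have hs : tsupport (χ * f) ⊆ (chartAt (Model n) c).source :=
      (tsupport_mul_subset_left).trans hχs
    refine ⟨hχ.mul hf, hfc.mul_left, ?_⟩
    rw [← integral_mul_divC hX (hχ.mul hf) hfc.mul_left hs]
    refine integral_congr_ae (Filter.Eventually.of_forall fun x => ?_)
    by_cases hx : x ∈ tsupport (χ * f)
    · simp only [divergence_eq_divC hX (hs hx)]
    · simp only [image_eq_zero_of_notMem_tsupport hx, zero_mul]

end Divergence

/-! ### Smoothness of gradients and the divergence form of the affine Laplacian. -/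

section Gradient

theorem contDiffAt_matrix_inv {E : Type*} [NormedAddCommGroup E] [NormedSpace ℝ E]
    {A : E → Matrix (Fin n) (Fin n) ℝ} {p : E}
    (hA : ∀ i j, ContDiffAt ℝ ∞ (fun q => A q i j) p) (hdet : (A p).det ≠ 0) (i j : Fin n) :
    ContDiffAt ℝ ∞ (fun q => (A q)⁻¹ i j) p := by
  simp only [Matrix.inv_def, Ring.inverse_eq_inv', Matrix.smul_apply, smul_eq_mul,
    Matrix.adjugate_apply]
  refine ((contDiffAt_matrix_det hA).inv hdet).mul (contDiffAt_matrix_det fun k l => ?_)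
  by_cases hk : k = j
  · subst hk
    simpa using contDiffAt_const
  · simpa [Matrix.updateRow_ne hk] using hA k l

theorem contMDiff_weight_rpow {u : M → ℝ} (hu : ContMDiff (𝓡 n) 𝓘(ℝ, ℝ) ∞ u) (a : ℝ) :
    ContMDiff (𝓡 n) 𝓘(ℝ, ℝ) ∞ fun x => weight u x ^ a := by
  have h : (fun x => weight u x ^ a) = (fun t : ℝ => Real.exp (t * a)) ∘ u := by
    ext x
    simp [weight, Real.exp_mul]
  rw [h]
  exact ContMDiff.comp (ContDiff.contMDiff (by fun_prop)) hu

theorem weight_pos {M : Type*} (u : M → ℝ) (x : M) : 0 < weight u x := Real.exp_pos _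

section
variable [RiemannianBundle (fun x : M => TangentSpace (𝓡 n) x)]

theorem inner_grad (f : M → ℝ) (x : M) (v : TangentSpace (𝓡 n) x) :
    inner ℝ (grad f x) v = mvfderiv (𝓡 n) f x v := by
  rw [grad]
  exact InnerProductSpace.toDual_symm_apply

end

variable [IsManifold (𝓡 n) ∞ M]

theorem mvfderiv_weight_rpow {u : M → ℝ} (hu : ContMDiff (𝓡 n) 𝓘(ℝ, ℝ) ∞ u) (a : ℝ) (x : M)
    (v : TangentSpace (𝓡 n) x) :
    mvfderiv (𝓡 n) (fun x => weight u x ^ a) x v =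
      a * weight u x ^ a * mvfderiv (𝓡 n) u x v := by
  have hx := mem_chart_source (Model n) x
  rw [← vec_coords hx v, mvfderiv_vec hx ((contMDiff_weight_rpow hu a).mdifferentiableAt (by simp)),
    mvfderiv_vec hx (hu.mdifferentiableAt (by simp))]
  have h1 : HasFDerivAt (u ∘ (chartAt (Model n) x).symm) _ (chartAt (Model n) x x) :=
    ((contDiffAt_toChart hu (mem_chart_target (Model n) x)).differentiableAt
      (by simp)).hasFDerivAt
  have h2 := (h1.mul_const a).exp
  have h3 : ((fun x => weight u x ^ a) ∘ (chartAt (Model n) x).symm) =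
      fun p => Real.exp ((u ∘ (chartAt (Model n) x).symm) p * a) := by
    ext p
    simp [weight, Real.exp_mul]
  rw [h3, h2.fderiv]
  simp [weight, Real.exp_mul]
  ring

variable [RiemannianBundle (fun x : M => TangentSpace (𝓡 n) x)]

/-- Pairing the gradient with the coordinate fields gives a linear system with the Gram matrix,
which is invertible; solving it yields the components gⁱʲ ∂ⱼf, from which smoothness is visible. -/
theorem coords_grad {c x : M} (hx : x ∈ (chartAt (Model n) c).source) {f : M → ℝ}
    (hf : MDifferentiableAt (𝓡 n) 𝓘(ℝ, ℝ) f x) (i : Fin n) :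
    coords c x (grad f x) i = ∑ j : Fin n, (gramMatrix c (chartAt (Model n) c x))⁻¹ i j *
      fderiv ℝ (f ∘ (chartAt (Model n) c).symm) (chartAt (Model n) c x)
        (EuclideanSpace.single j 1) := by
  rw [gramMatrix_eq_gramAt ((chartAt (Model n) c).map_source hx), (chartAt (Model n) c).left_inv hx]
  have h : (gramAt n c x).mulVec (fun k => coords c x (grad f x) k) = fun j =>
      fderiv ℝ (f ∘ (chartAt (Model n) c).symm) (chartAt (Model n) c x)
        (EuclideanSpace.single j 1) := by
    ext j
    rw [← mvfderiv_vec hx hf, ← inner_grad]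
    conv_rhs => rw [← vec_coords hx (grad f x), model_eq_sum (coords c x (grad f x)), map_sum,
      sum_inner]
    simp only [Matrix.mulVec, dotProduct, gramAt, Matrix.gram_apply, map_smul, inner_smul_left]
    refine Finset.sum_congr rfl fun k _ => ?_
    rw [real_inner_comm]
    simp [mul_comm]
  have h2 : (gramAt n c x)⁻¹.mulVec ((gramAt n c x).mulVec (fun k => coords c x (grad f x) k)) =
      fun k => coords c x (grad f x) k := by
    rw [Matrix.mulVec_mulVec, Matrix.nonsing_inv_mul _ (gramAt_det_pos hx).ne'.isUnit,
      Matrix.one_mulVec]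
  rw [h] at h2
  exact (congrFun h2 i).symm

variable [IsContMDiffRiemannianBundle (𝓡 n) ∞ (Model n) (fun x : M => TangentSpace (𝓡 n) x)]

theorem contMDiffAt_grad {f : M → ℝ} {U : Set M} (hU : IsOpen U)
    (hf : ∀ y ∈ U, ContMDiffAt (𝓡 n) 𝓘(ℝ, ℝ) ∞ f y) {x : M} (hxU : x ∈ U) :
    ContMDiffAt (𝓡 n) (𝓡 n).tangent ∞ (fun y => (⟨y, grad f y⟩ : TangentBundle (𝓡 n) M)) x := by
  have hx := mem_chart_source (Model n) x
  have hx' := mem_chart_target (Model n) x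
  rw [contMDiffAt_coords_iff hx]
  have h : ContDiffAt ℝ ∞ (fun p => ∑ i : Fin n, (∑ j : Fin n, (gramMatrix x p)⁻¹ i j *
      fderiv ℝ (f ∘ (chartAt (Model n) x).symm) p (EuclideanSpace.single j 1)) •
      (EuclideanSpace.single i 1 : Model n)) (chartAt (Model n) x x) := by
    refine ContDiffAt.sum fun i _ => ContDiffAt.fun_smul (ContDiffAt.sum fun j _ => ?_) contDiffAt_const
    refine (contDiffAt_matrix_inv (fun i j => contDiffAt_gramMatrix hx' i j) ?_ i j).mul ?_
    · exact (Real.sqrt_pos.1 (volDensity_pos hx')).ne'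
    · exact ((contDiffAt_comp_chart_symm hx (hf x hxU)).fderiv_right (m := ∞) (by simp)).clm_apply
        contDiffAt_const
  refine (contMDiffAt_comp_chart hx h).congr_of_eventuallyEq ?_
  filter_upwards [(chartAt (Model n) x).open_source.mem_nhds hx, hU.mem_nhds hxU] with y hy hyU
  rw [model_eq_sum (coords x y (grad f y))]
  exact Finset.sum_congr rfl fun i _ => by
    rw [coords_grad hy ((hf y hyU).mdifferentiableAt (by simp))]

theorem isSmoothField_grad {f : M → ℝ} (hf : ContMDiff (𝓡 n) 𝓘(ℝ, ℝ) ∞ f) :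
    IsSmoothField fun x => grad (n := n) f x := fun _ =>
  contMDiffAt_grad isOpen_univ (fun y _ => hf y) (mem_univ _)

/-- The affine Laplacian is a weighted divergence. -/
theorem affineLaplacian_mul_weight {u f : M → ℝ} (hu : ContMDiff (𝓡 n) 𝓘(ℝ, ℝ) ∞ u)
    (hf : ContMDiff (𝓡 n) 𝓘(ℝ, ℝ) ∞ f) (lam mu : ℝ) (x : M) :
    affineLaplacian (n := n) lam mu u f x * weight u x ^ tau n lam mu =
      divergence (fun y => (weight u y ^ (n * lam + 2 * mu)) • grad (n := n) f y) x := by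
  have h := divC_smul (isSmoothField_grad hf) (contMDiff_weight_rpow hu (n * lam + 2 * mu))
    (mem_chart_source (Model n) x)
  change _ = divC x _ x
  rw [h, mvfderiv_weight_rpow hu, affineLaplacian, ← inner_grad]
  change _ = _ * laplacian f x + _
  -- The exponent k = nλ + 2μ equals (μ - λ) + τ and is also the coefficient of ⟨∇u, ∇f⟩ in Δ^D, so
  -- the Leibniz rule for div(V^k ∇f) produces the drift term exactly.
  have hw : weight u x ^ (n * lam + 2 * mu) =
      weight u x ^ (mu - lam) * weight u x ^ tau n lam mu := by
    rw [← Real.rpow_add (weight_pos u x), tau]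
    congr 1
    ring
  rw [hw]
  ring

end Gradient

/-! ### Mollification of functions with bounded weak partial derivatives in Euclidean space. -/

section Mollify

open ContinuousLinearMap
open scoped Convolution

/-- A normalised bump is a probability density, so convolution with it is an average and preserves
essential bounds. -/
theorem abs_bump_convolution_le (φ : ContDiffBump (0 : Model n)) {g : Model n → ℝ} {B : ℝ}
    (hg : ∀ᵐ p ∂(volume : Measure (Model n)), |g p| ≤ B) (p : Model n) :
    |(φ.normed volume ⋆[lsmul ℝ ℝ, volume] g) p| ≤ B := by
  rw [convolution_lsmul_swap]
  have hi : Integrable fun t => B * φ.normed volume (p - t) :=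
    (φ.integrable_normed.comp_sub_left p).const_mul B
  have h1 : ∫ t, B * φ.normed volume (p - t) = B := by
    rw [integral_const_mul, integral_sub_left_eq_self (fun t => φ.normed volume t) volume p,
      φ.integral_normed, mul_one]
  rw [← h1, ← Real.norm_eq_abs]
  refine norm_integral_le_of_norm_le hi ?_
  filter_upwards [hg] with t ht
  rw [norm_smul, Real.norm_of_nonneg (φ.nonneg_normed _), mul_comm, Real.norm_eq_abs]
  exact mul_le_mul_of_nonneg_right ht (φ.nonneg_normed _)

theorem bump_convolution_comm (φ : ContDiffBump (0 : Model n)) (r : Model n → ℝ) :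
    (φ.normed volume ⋆[lsmul ℝ ℝ, volume] r) = r ⋆[mul ℝ ℝ, volume] φ.normed volume := by
  ext p
  rw [convolution_lsmul_swap, convolution_def]
  simp [mul_comm]

theorem contDiff_bump_convolution (φ : ContDiffBump (0 : Model n)) {r : Model n → ℝ}
    (hr : LocallyIntegrable r) :
    ContDiff ℝ ∞ (φ.normed volume ⋆[lsmul ℝ ℝ, volume] r) := by
  rw [bump_convolution_comm]
  exact φ.hasCompactSupport_normed.contDiff_convolution_right _ hr φ.contDiff_normed

theorem fderiv_bump_convolution (φ : ContDiffBump (0 : Model n)) {r : Model n → ℝ}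
    (hr : LocallyIntegrable r) (p v : Model n) :
    fderiv ℝ (φ.normed volume ⋆[lsmul ℝ ℝ, volume] r) p v =
      ∫ t, r t * fderiv ℝ (φ.normed volume) (p - t) v := by
  have h1 : ContDiff ℝ 1 (φ.normed volume) := φ.contDiff_normed (n := 1)
  rw [bump_convolution_comm, (φ.hasCompactSupport_normed.hasFDerivAt_convolution_right
    (mul ℝ ℝ) hr h1 p).fderiv, convolution_precompR_apply _ hr
      (φ.hasCompactSupport_normed.fderiv ℝ) (h1.continuous_fderiv (by simp)), convolution_def]
  simp

/-- `g` is the weak partial derivative of `r` on `W` in the direction `v`. -/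
def IsWeakPartialOn (W : Set (Model n)) (r g : Model n → ℝ) (v : Model n) : Prop :=
  ∀ F : Model n → ℝ, ContDiff ℝ ∞ F → HasCompactSupport F → tsupport F ⊆ W →
    Integrable (fun p => F p * g p) ∧ ∫ p, F p * g p = - ∫ p, r p * fderiv ℝ F p v

/-- Testing against a smooth cutoff equal to 1 on `K` extracts integrability of `g` itself from the
integrability of the products. -/
theorem IsWeakPartialOn.integrableOn {W K : Set (Model n)} {r g : Model n → ℝ} {v : Model n}
    (h : IsWeakPartialOn W r g v) (hW : IsOpen W) (hK : IsCompact K) (hKW : K ⊆ W) :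
    IntegrableOn g K := by
  obtain ⟨δ, hδ, hδW⟩ := hK.exists_cthickening_subset_open hW hKW
  obtain ⟨F, hF1, hF0, -⟩ := exists_contMDiffMap_one_nhds_of_subset_interior 𝓘(ℝ, Model n)
    (n := (⊤ : ℕ∞)) (s := K) (t := Metric.cthickening δ K) hK.isClosed
    ((Metric.self_subset_thickening hδ K).trans (Metric.thickening_subset_interior_cthickening δ K))
  have hFs : tsupport F ⊆ Metric.cthickening δ K :=
    closure_minimal (fun x hx => by by_contra h; exact hx (hF0 x h)) Metric.isClosed_cthickening
  have hFc : HasCompactSupport F :=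
    HasCompactSupport.of_support_subset_isCompact hK.cthickening ((subset_tsupport _).trans hFs)
  have hi := (h F F.contMDiff.contDiff hFc (hFs.trans hδW)).1
  refine hi.integrableOn.congr_fun (fun p hp => ?_) hK.measurableSet
  simp [hF1.self_of_nhdsSet p hp]

/-- Local mollification of a continuous function with bounded weak partial derivatives. -/
theorem exists_mollification {W K : Set (Model n)} (hW : IsOpen W) (hK : IsCompact K)
    (hKW : K ⊆ W) {r : Model n → ℝ} (hr : ContinuousOn r W) (hr0 : ∀ p ∈ W, 0 ≤ r p)
    {g : Fin n → Model n → ℝ}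
    (hg : ∀ i, IsWeakPartialOn W r (g i) (EuclideanSpace.single i 1))
    (hgb : ∀ i, ∀ S ⊆ W, IsCompact S → ∃ B, ∀ᵐ p ∂(volume : Measure (Model n)),
      p ∈ S → |g i p| ≤ B) :
    ∃ (R : ℕ → Model n → ℝ) (B : ℝ), (∀ m, ContDiff ℝ ∞ (R m)) ∧ (∀ m p, 0 ≤ R m p) ∧
      (∀ m, ∀ p ∈ K, |R m p| ≤ B) ∧
      (∀ m, ∀ p ∈ K, ∀ i, |fderiv ℝ (R m) p (EuclideanSpace.single i 1)| ≤ B) ∧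
      ∀ᵐ p ∂(volume : Measure (Model n)), p ∈ K →
        Filter.Tendsto (fun m => R m p) Filter.atTop (𝓝 (r p)) ∧
        ∀ i, Filter.Tendsto (fun m => fderiv ℝ (R m) p (EuclideanSpace.single i 1)) Filter.atTop
          (𝓝 (g i p)) := by
  obtain ⟨δ, hδ, hδW⟩ := hK.exists_cthickening_subset_open hW hKW
  set S := Metric.cthickening δ K
  have hS : IsCompact S := hK.cthickening
  have hKS : K ⊆ S := Metric.self_subset_cthickening K
  -- Truncation to a compact neighbourhood of `K` makes the convolutions globally defined. It does
  -- not affect them on `K`, since all mollifier radii are at most `δ`.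
  set r' := S.indicator r
  set g' : Fin n → Model n → ℝ := fun i => S.indicator (g i)
  have hr' : Integrable r' :=
    ((hr.mono hδW).integrableOn_compact hS).integrable_indicator hS.measurableSet
  have hg' : ∀ i, Integrable (g' i) := fun i =>
    ((hg i).integrableOn hW hS hδW).integrable_indicator hS.measurableSet
  obtain ⟨B₀, hB₀⟩ := hS.exists_bound_of_continuousOn (hr.mono hδW)
  choose B₁ hB₁ using fun i => hgb i S hδW hS
  set B := max B₀ 0 + ∑ i, max (B₁ i) 0
  have hBn : 0 ≤ ∑ i, max (B₁ i) 0 := Finset.sum_nonneg fun i _ => le_max_right _ _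
  have hBr : ∀ p, |r' p| ≤ B := fun p => by
    by_cases hp : p ∈ S
    · simp only [r', indicator_of_mem hp]
      have := hB₀ p hp
      rw [Real.norm_eq_abs] at this
      have := le_max_left B₀ 0
      simp only [B]; linarith
    · simp only [r', indicator_of_notMem hp, abs_zero]
      have := le_max_right B₀ 0
      simp only [B]; linarith
  have hBg : ∀ i, ∀ᵐ p ∂(volume : Measure (Model n)), |g' i p| ≤ B := fun i => by
    have h1 : max (B₁ i) 0 ≤ ∑ i, max (B₁ i) 0 :=
      Finset.single_le_sum (f := fun i => max (B₁ i) 0) (fun i _ => le_max_right _ _)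
        (Finset.mem_univ i)
    have h2 := le_max_right B₀ 0
    filter_upwards [hB₁ i] with p hp
    by_cases hpS : p ∈ S
    · simp only [g', indicator_of_mem hpS]
      have := hp hpS
      have := le_max_left (B₁ i) 0
      simp only [B]; linarith
    · simp only [g', indicator_of_notMem hpS, abs_zero]
      simp only [B]; linarith
  have hpos : ∀ m : ℕ, 0 < δ / (m + 1) := fun m => by positivity
  -- The outer radii tend to 0 and never exceed `δ`; the fixed ratio 2 of the radii is the condition
  -- `hφK` under which mollifications of merely integrable functions converge almost everywhere.
  set φ : ℕ → ContDiffBump (0 : Model n) := fun m =>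
    ⟨δ / (m + 1) / 2, δ / (m + 1), half_pos (hpos m), half_lt_self (hpos m)⟩
  have hφ : ∀ m, (φ m).rOut ≤ δ := fun m => by
    refine div_le_self hδ.le ?_
    have : (0 : ℝ) ≤ m := Nat.cast_nonneg m
    linarith
  have hφ0 : Filter.Tendsto (fun m => (φ m).rOut) Filter.atTop (𝓝 0) := by
    have := (tendsto_one_div_add_atTop_nhds_zero_nat (𝕜 := ℝ)).const_mul δ
    simpa [φ, div_eq_mul_inv] using this
  have hφK : ∀ᶠ m in Filter.atTop, (φ m).rOut ≤ 2 * (φ m).rIn :=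
    Filter.Eventually.of_forall fun m => by simp only [φ]; linarith
  have hder : ∀ m, ∀ p ∈ K, ∀ i, fderiv ℝ ((φ m).normed volume ⋆[lsmul ℝ ℝ, volume] r') p
      (EuclideanSpace.single i 1) = ((φ m).normed volume ⋆[lsmul ℝ ℝ, volume] g' i) p := by
    intro m p hp i
    rw [fderiv_bump_convolution _ hr'.locallyIntegrable, convolution_lsmul_swap]
    -- The reflected and translated bump is an admissible test function, as its support lies in `S`
    -- for `p ∈ K`. The weak derivative identity for it says that differentiation commutes with
    -- mollification on `K`; the reflection accounts for the sign.
    set F : Model n → ℝ := fun t => (φ m).normed volume (p - t)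
    have hF : ContDiff ℝ ∞ F :=
      ((φ m).contDiff_normed (n := ⊤)).comp (contDiff_const.sub contDiff_id)
    have hsub : ∀ t ∉ S, p - t ∉ tsupport ((φ m).normed volume) := fun t ht h => by
      rw [(φ m).tsupport_normed_eq, mem_closedBall_zero_iff] at h
      refine ht (Metric.mem_cthickening_of_dist_le t p δ K hp ?_)
      rw [dist_comm, dist_eq_norm]
      exact h.trans (hφ m)
    have hFs : tsupport F ⊆ S := by
      refine closure_minimal (fun t ht => ?_) hS.isClosed
      by_contra h
      exact ht (image_eq_zero_of_notMem_tsupport (f := (φ m).normed volume) (hsub t h))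
    have hFc : HasCompactSupport F :=
      HasCompactSupport.of_support_subset_isCompact hS ((subset_tsupport _).trans hFs)
    have hdF : ∀ t v, fderiv ℝ F t v = - fderiv ℝ ((φ m).normed volume) (p - t) v := fun t v => by
      have h1 : HasFDerivAt ((φ m).normed volume) _ (p - t) :=
        (((φ m).contDiff_normed (n := 1)).differentiable (by simp) (p - t)).hasFDerivAt
      have h2 := h1.comp t ((hasFDerivAt_const p t).sub (hasFDerivAt_id t))
      have h3 : fderiv ℝ F t = _ := h2.fderiv
      rw [h3]
      simp
    have h := (hg i F hF hFc (hFs.trans hδW)).2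
    have e1 : ∫ t, F t * g i t = ∫ t, (φ m).normed volume (p - t) • g' i t := by
      refine integral_congr_ae (Filter.Eventually.of_forall fun t => ?_)
      by_cases ht : t ∈ S
      · simp [F, g', indicator_of_mem ht]
      · simp [F, g', indicator_of_notMem ht, image_eq_zero_of_notMem_tsupport (hsub t ht)]
    have e2 : - ∫ t, r t * fderiv ℝ F t (EuclideanSpace.single i 1) =
        ∫ t, r' t * fderiv ℝ ((φ m).normed volume) (p - t) (EuclideanSpace.single i 1) := by
      rw [← integral_neg]
      refine integral_congr_ae (Filter.Eventually.of_forall fun t => ?_)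
      simp only [hdF]
      by_cases ht : t ∈ S
      · simp [r', indicator_of_mem ht]
      · have h0 : fderiv ℝ ((φ m).normed volume) (p - t) = 0 :=
          image_eq_zero_of_notMem_tsupport fun h => hsub t ht (tsupport_fderiv_subset ℝ h)
        simp [h0]
    rw [← e2, ← e1, h]
  refine ⟨fun m => (φ m).normed volume ⋆[lsmul ℝ ℝ, volume] r', B,
    fun m => contDiff_bump_convolution _ hr'.locallyIntegrable, fun m p => ?_,
    fun m p _ => abs_bump_convolution_le _ (Filter.Eventually.of_forall hBr) p,
    fun m p hp i => ?_, ?_⟩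
  · change 0 ≤ ((φ m).normed volume ⋆[lsmul ℝ ℝ, volume] r') p
    rw [convolution_lsmul_swap]
    refine integral_nonneg fun t => smul_nonneg ((φ m).nonneg_normed _) ?_
    exact indicator_nonneg (fun q hq => hr0 q (hδW hq)) t
  · rw [hder m p hp i]
    exact abs_bump_convolution_le _ (hBg i) p
  · have c1 := ContDiffBump.ae_convolution_tendsto_right_of_locallyIntegrable
      (μ := volume) hφ0 hφK hr'.locallyIntegrable
    have c2 := ae_all_iff.2 fun i => ContDiffBump.ae_convolution_tendsto_right_of_locallyIntegrable
      (μ := volume) hφ0 hφK (hg' i).locallyIntegrable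
    filter_upwards [c1, c2] with p h1 h2 hp
    refine ⟨?_, fun i => ?_⟩
    · simpa only [r', indicator_of_mem (hKS hp)] using h1
    · have := h2 i
      simp only [g', indicator_of_mem (hKS hp)] at this
      exact this.congr fun m => (hder m p hp i).symm

end Mollify

/-! ### The distributional gradient of ρ in charts. -/

section WeakGradient

variable [IsManifold (𝓡 n) ∞ M] [RiemannianBundle (fun x : M => TangentSpace (𝓡 n) x)]

theorem divergence_eq_zero_of_eventuallyEq {X : ∀ x : M, TangentSpace (𝓡 n) x} {x : M}
    (h : ∀ᶠ y in 𝓝 x, X y = 0) : divergence X x = 0 := by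
  have hx := mem_chart_source (Model n) x
  have hx' := mem_chart_target (Model n) x
  have hc : Filter.Tendsto (chartAt (Model n) x).symm (𝓝 (chartAt (Model n) x x)) (𝓝 x) := by
    have := (chartAt (Model n) x).continuousAt_symm hx'
    rwa [ContinuousAt, (chartAt (Model n) x).left_inv hx] at this
  have h1 : ∀ i : Fin n, (fun p : Model n => volDensity x p * coordComp x X p i)
      =ᶠ[𝓝 (chartAt (Model n) x x)] fun _ => (0 : ℝ) := fun i => by
    filter_upwards [hc.eventually h, (chartAt (Model n) x).open_target.mem_nhds hx'] with p hp hpT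
    rw [coordComp_eq_coords X hpT, hp, map_zero]
    simp
  simp [divergence, (h1 _).fderiv_eq]

variable [IsContMDiffRiemannianBundle (𝓡 n) ∞ (Model n) (fun x : M => TangentSpace (𝓡 n) x)]
  [MeasurableSpace M] [BorelSpace M]

/-- The components of a field of controlled length are locally bounded in charts. -/
theorem ae_bound_inner_vec {Ω : Set M} {G : ∀ x : M, TangentSpace (𝓡 n) x} {w : M → ℝ}
    (hw : Continuous w) (hG : ∀ᵐ x ∂(riemannianVolume n M), x ∈ Ω → ‖G x‖ ≤ w x)
    (c : M) (i : Fin n) {S : Set (Model n)}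
    (hS : S ⊆ (chartAt (Model n) c).target ∩ (chartAt (Model n) c).symm ⁻¹' Ω)
    (hSc : IsCompact S) :
    ∃ B, ∀ᵐ p ∂(volume : Measure (Model n)), p ∈ S →
      |((fun x => inner ℝ (G x) (vec c x (EuclideanSpace.single i 1))) ∘
        (chartAt (Model n) c).symm) p| ≤ B := by
  have hcont : ContinuousOn (fun p => w ((chartAt (Model n) c).symm p) *
      Real.sqrt (gramMatrix c p i i)) S := by
    refine ContinuousOn.mul ?_ ?_
    · exact hw.comp_continuousOn
        ((chartAt (Model n) c).continuousOn_symm.mono (hS.trans inter_subset_left))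
    · exact Real.continuous_sqrt.comp_continuousOn fun p hp =>
        (contDiffAt_gramMatrix (hS hp).1 i i).continuousAt.continuousWithinAt
  obtain ⟨B, hB⟩ := hSc.exists_bound_of_continuousOn hcont
  refine ⟨B, ?_⟩
  have h := ae_chart_symm_of_ae (c := c) (Q := fun x => x ∈ Ω → ‖G x‖ ≤ w x)
    (hG.mono fun x hx _ => hx)
  filter_upwards [h] with p hp hpS
  refine le_trans ?_ ((le_abs_self _).trans (hB p hpS))
  have hT := (hS hpS).1
  refine (abs_real_inner_le_norm _ _).trans ?_
  have h2 : ‖vec c ((chartAt (Model n) c).symm p) (EuclideanSpace.single i 1)‖ =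
      Real.sqrt (gramMatrix c p i i) := by
    rw [gramMatrix_eq_gramAt hT, gramAt, Matrix.gram_apply, real_inner_self_eq_norm_sq,
      Real.sqrt_sq (norm_nonneg _)]
  rw [h2]
  exact mul_le_mul_of_nonneg_right (hp hT (hS hpS).2) (Real.sqrt_nonneg _)

variable [T2Space M] [SecondCountableTopology M]

/-- Distributional gradients are given by weak partial derivatives in charts. -/
theorem IsWeakGradientOn.isWeakPartialOn {Ω : Set M} {ρ : M → ℝ} (hρ : Continuous ρ)
    {G : ∀ x : M, TangentSpace (𝓡 n) x} (hG : IsWeakGradientOn Ω ρ G) (c : M) (i : Fin n) :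
    IsWeakPartialOn ((chartAt (Model n) c).target ∩ (chartAt (Model n) c).symm ⁻¹' Ω)
      (ρ ∘ (chartAt (Model n) c).symm)
      ((fun x => inner ℝ (G x) (vec c x (EuclideanSpace.single i 1))) ∘
        (chartAt (Model n) c).symm) (EuclideanSpace.single i 1) := by
  intro F hF hFc hFs
  have hmt := (chartAt (Model n) c).open_target.measurableSet
  have hFT := hFs.trans inter_subset_left
  obtain ⟨hK, hKs⟩ := tsupport_ofChart (M := M) hFc hFT
  have hsmooth := contMDiff_ofChart (M := M) hF hFc hFT
  have hsrc : tsupport (ofChart c F) ⊆ (chartAt (Model n) c).source := by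
    refine hKs.trans ?_
    rintro _ ⟨p, hp, rfl⟩
    exact (chartAt (Model n) c).map_target (hFT hp)
  -- Dividing by the volume density makes the density times div X equal to ∂ᵢF, so the defining
  -- identity of the distributional gradient becomes the Euclidean one.
  set X : ∀ x : M, TangentSpace (𝓡 n) x := fun x => ofChart c F x •
    ((volDensity c (chartAt (Model n) c x))⁻¹ • vec c x (EuclideanSpace.single i 1))
  have hX : IsSmoothField X := by
    refine isSmoothField_smul_of_tsupport hsmooth hsrc fun x hx => ?_
    rw [contMDiffAt_coords_iff hx]
    have h1 : ContDiffAt ℝ ∞ (fun p => (volDensity c p)⁻¹ •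
        (EuclideanSpace.single i 1 : Model n)) (chartAt (Model n) c x) := by
      have hx' := (chartAt (Model n) c).map_source hx
      exact ((contDiffAt_volDensity hx').inv (volDensity_pos hx').ne').fun_smul contDiffAt_const
    refine (contMDiffAt_comp_chart hx h1).congr_of_eventuallyEq ?_
    filter_upwards [(chartAt (Model n) c).open_source.mem_nhds hx] with y hy
    rw [map_smul, coords_vec hy]
  have hX0 : ∀ x ∉ tsupport (ofChart c F), X x = 0 := fun x hx => by
    simp only [X, image_eq_zero_of_notMem_tsupport hx, zero_smul]
  obtain ⟨hint, heq⟩ := hG X hX ⟨_, hK, by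
    rintro _ ⟨p, hp, rfl⟩
    exact (hFs hp).2, fun x hx => hX0 x fun h => hx (hKs h)⟩
  have hinner : ∀ p ∈ (chartAt (Model n) c).target, volDensity c p *
      inner ℝ (G ((chartAt (Model n) c).symm p)) (X ((chartAt (Model n) c).symm p)) =
      F p * inner ℝ (G ((chartAt (Model n) c).symm p))
        (vec c ((chartAt (Model n) c).symm p) (EuclideanSpace.single i 1)) := fun p hp => by
    have h1 := (volDensity_pos hp).ne'
    have h2 : ofChart c F ((chartAt (Model n) c).symm p) = F p := by
      simp [ofChart, (chartAt (Model n) c).map_target hp, (chartAt (Model n) c).right_inv hp]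
    simp only [X, inner_smul_right, h2, (chartAt (Model n) c).right_inv hp]
    field_simp
  have hF0 : ∀ p ∉ (chartAt (Model n) c).target, F p = 0 := fun p hp =>
    image_eq_zero_of_notMem_tsupport fun h => hp (hFT h)
  have hdiv : ∀ p ∈ (chartAt (Model n) c).target,
      volDensity c p * divergence X ((chartAt (Model n) c).symm p) =
        fderiv ℝ F p (EuclideanSpace.single i 1) := fun p hp => by
    have h1 := (volDensity_pos hp).ne'
    have h2 : ∀ j : Fin n, (fun q : Model n => volDensity c q * coordComp c X q j) =ᶠ[𝓝 p]
        fun q => F q * (EuclideanSpace.single i 1 : Model n) j := fun j => by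
      filter_upwards [(chartAt (Model n) c).open_target.mem_nhds hp] with q hq
      have h3 := (volDensity_pos hq).ne'
      have h2 : ofChart c F ((chartAt (Model n) c).symm q) = F q := by
        simp [ofChart, (chartAt (Model n) c).map_target hq, (chartAt (Model n) c).right_inv hq]
      rw [coordComp_eq_coords X hq]
      simp only [X, map_smul, coords_vec ((chartAt (Model n) c).map_target hq), h2,
        (chartAt (Model n) c).right_inv hq, PiLp.smul_apply, smul_eq_mul]
      field_simp
    have h3 : ∀ j : Fin n, fderiv ℝ (fun q : Model n => volDensity c q * coordComp c X q j) p
        (EuclideanSpace.single j 1) =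
        (EuclideanSpace.single i 1 : Model n) j * fderiv ℝ F p (EuclideanSpace.single j 1) :=
      fun j => by
        rw [(h2 j).fderiv_eq, fderiv_mul_const (hF.differentiable (by simp) p)]
        rfl
    rw [divergence_eq_divC hX ((chartAt (Model n) c).map_target hp), divC,
      (chartAt (Model n) c).right_inv hp, mul_inv_cancel_left₀ h1]
    simp only [h3]
    rw [Finset.sum_eq_single i (fun j _ hj => by simp [hj]) (by simp)]
    simp
  have hl : ∫ x, inner ℝ (G x) (X x) ∂(riemannianVolume n M) =
      ∫ p, F p * inner ℝ (G ((chartAt (Model n) c).symm p))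
        (vec c ((chartAt (Model n) c).symm p) (EuclideanSpace.single i 1)) := by
    rw [integral_eq_chart hint.aestronglyMeasurable fun x hx => by
      rw [hX0 x fun h => hx (hsrc h), inner_zero_right]]
    refine (setIntegral_congr_fun hmt hinner).trans
      (setIntegral_eq_integral_of_forall_compl_eq_zero fun p hp => ?_)
    rw [hF0 p hp, zero_mul]
  have hr : ∫ x, ρ x * divergence X x ∂(riemannianVolume n M) =
      ∫ p, ρ ((chartAt (Model n) c).symm p) * fderiv ℝ F p (EuclideanSpace.single i 1) := by
    rw [integral_eq_chart (c := c) (f := fun x => ρ x * divergence X x)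
      (hρ.mul hX.contMDiff_divergence.continuous).aestronglyMeasurable fun x hx => ?_]
    · refine (setIntegral_congr_fun hmt fun p hp => ?_).trans
        (setIntegral_eq_integral_of_forall_compl_eq_zero fun p hp => ?_)
      · rw [← hdiv p hp]
        ring
      · have h0 : fderiv ℝ F p = 0 :=
          image_eq_zero_of_notMem_tsupport fun h => hp (hFT (tsupport_fderiv_subset ℝ h))
        simp [h0]
    · rw [divergence_eq_zero_of_eventuallyEq, mul_zero]
      filter_upwards [(isClosed_tsupport (ofChart c F)).isOpen_compl.mem_nhds
        fun h => hx (hsrc h)] with y hy using hX0 y hy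
  refine ⟨?_, ?_⟩
  · have h1 := (integrableOn_chart (c := c) hint).congr_fun hinner hmt
    refine (integrableOn_iff_integrable_of_support_subset fun p hp => ?_).1 h1
    by_contra h
    exact hp (by simp [hF0 p h])
  · rw [hl, hr] at heq
    exact heq

end WeakGradient

/-! ### The energy inequality for test functions supported in a chart. -/

section LocalEnergy

variable [IsManifold (𝓡 n) ∞ M] [RiemannianBundle (fun x : M => TangentSpace (𝓡 n) x)]
  [IsContMDiffRiemannianBundle (𝓡 n) ∞ (Model n) (fun x : M => TangentSpace (𝓡 n) x)]
  [MeasurableSpace M]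
  {u : M → ℝ} {lam mu : ℝ} {ρ : M → ℝ} {G : ∀ x : M, TangentSpace (𝓡 n) x} {Ω : Set M}

/-- Test the distributional gradient with the field V^a ∇f. For a = nλ + 2μ the right side is the
integral occurring in the distributional Laplacian bound. -/
theorem IsWeakGradientOn.integrable_mvfderiv (hu : ContMDiff (𝓡 n) 𝓘(ℝ, ℝ) ∞ u)
    (hG : IsWeakGradientOn Ω ρ G) (a : ℝ) {f : M → ℝ} (hf : ContMDiff (𝓡 n) 𝓘(ℝ, ℝ) ∞ f)
    (hfc : HasCompactSupport f) (hfs : tsupport f ⊆ Ω) :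
    Integrable (fun x => weight u x ^ a * mvfderiv (𝓡 n) f x (G x)) (riemannianVolume n M) ∧
    ∫ x, weight u x ^ a * mvfderiv (𝓡 n) f x (G x) ∂(riemannianVolume n M) =
      - ∫ x, ρ x * divergence (fun y => (weight u y ^ a) • grad (n := n) f y) x
        ∂(riemannianVolume n M) := by
  have h := hG (fun y => (weight u y ^ a) • grad (n := n) f y)
    ((isSmoothField_grad hf).smul (contMDiff_weight_rpow hu a))
    ⟨tsupport f, hfc, hfs, fun x hx => by
      rw [grad, mvfderiv_of_notMem_tsupport hx, map_zero, smul_zero]⟩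
  have h1 : ∀ x, inner ℝ (G x) ((weight u x ^ a) • grad (n := n) f x) =
      weight u x ^ a * mvfderiv (𝓡 n) f x (G x) := fun x => by
    rw [inner_smul_right, real_inner_comm, inner_grad]
  simpa only [h1] using h

/-- The i-th component of G is ⟨G, ∇xⁱ⟩, so the admissible field V^a f ∇xⁱ isolates it. These
integrable functions enter the dominating function of the limit argument. -/
theorem IsWeakGradientOn.integrable_coords (hu : ContMDiff (𝓡 n) 𝓘(ℝ, ℝ) ∞ u)
    (hG : IsWeakGradientOn Ω ρ G) (a : ℝ) {f : M → ℝ} (hf : ContMDiff (𝓡 n) 𝓘(ℝ, ℝ) ∞ f)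
    (hfc : HasCompactSupport f) (hfs : tsupport f ⊆ Ω) {c : M}
    (hfsrc : tsupport f ⊆ (chartAt (Model n) c).source) (i : Fin n) :
    Integrable (fun x => weight u x ^ a * f x * coords c x (G x) i) (riemannianVolume n M) := by
  set ξ : M → ℝ := fun y => chartAt (Model n) c y i
  have hξ : ∀ x ∈ (chartAt (Model n) c).source, ContMDiffAt (𝓡 n) 𝓘(ℝ, ℝ) ∞ ξ x := fun x hx =>
    contMDiffAt_comp_chart hx (f := fun p : Model n => p i)
      (EuclideanSpace.proj (𝕜 := ℝ) i : Model n →L[ℝ] ℝ).contDiff.contDiffAt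
  have hX := (isSmoothField_smul_of_tsupport hf hfsrc
    fun x hx => contMDiffAt_grad (chartAt (Model n) c).open_source hξ hx).smul
    (contMDiff_weight_rpow hu a)
  have h := (hG _ hX ⟨tsupport f, hfc, hfs, fun x hx => by
    rw [image_eq_zero_of_notMem_tsupport hx, zero_smul, smul_zero]⟩).1
  refine h.congr (Filter.Eventually.of_forall fun x => ?_)
  by_cases hx : x ∈ tsupport f
  · simp only
    rw [inner_smul_right, inner_smul_right, real_inner_comm, inner_grad,
      coords_apply_coord (hfsrc hx)]
    ring
  · simp [image_eq_zero_of_notMem_tsupport hx]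

variable [BorelSpace M]

theorem IsWeakGradientOn.integrable_mul_mvfderiv (hu : ContMDiff (𝓡 n) 𝓘(ℝ, ℝ) ∞ u)
    (hρ : Continuous ρ)
    (hG : IsWeakGradientOn Ω ρ G) (a : ℝ) {f : M → ℝ} (hf : ContMDiff (𝓡 n) 𝓘(ℝ, ℝ) ∞ f)
    (hfc : HasCompactSupport f) (hfs : tsupport f ⊆ Ω) :
    Integrable (fun x => ρ x * (weight u x ^ a * mvfderiv (𝓡 n) f x (G x)))
      (riemannianVolume n M) := by
  have h := (hG.integrable_mvfderiv hu a hf hfc hfs).1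
  obtain ⟨B, hB⟩ := IsCompact.exists_bound_of_continuousOn hfc hρ.continuousOn
  refine (h.norm.const_mul |B|).mono' (hρ.aestronglyMeasurable.mul h.aestronglyMeasurable)
    (Filter.Eventually.of_forall fun x => ?_)
  rw [norm_mul]
  by_cases hx : x ∈ tsupport f
  · exact mul_le_mul_of_nonneg_right ((hB x hx).trans (le_abs_self B)) (norm_nonneg _)
  · rw [mvfderiv_of_notMem_tsupport hx]
    simp

variable [T2Space M] [SecondCountableTopology M]

/-- The inequality obtained by testing the Laplacian bound with `ρ η`, for `η` supported in a
chart domain. -/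
theorem local_energy_inequality (hu : ContMDiff (𝓡 n) 𝓘(ℝ, ℝ) ∞ u) (hρ : Continuous ρ)
    (hρ0 : ∀ x, 0 ≤ ρ x) {C : ℝ} (hG : IsWeakGradientOn {x | ρ x ≠ 0} ρ G)
    (hGn : ∀ᵐ x ∂(riemannianVolume n M), x ∈ {x | ρ x ≠ 0} →
      ‖(weight u x ^ (mu - lam)) • G x‖ = 1)
    (hlap : AffineLaplacianGEOn n {x | ρ x ≠ 0} lam mu u ρ
      (fun x => C / ρ x * weight u x ^ (lam - mu)))
    {η : M → ℝ} (hη : ContMDiff (𝓡 n) 𝓘(ℝ, ℝ) ∞ η) (hηc : HasCompactSupport η)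
    (hη0 : ∀ x, 0 ≤ η x) (hηs : tsupport η ⊆ {x | ρ x ≠ 0}) {c : M}
    (hηsrc : tsupport η ⊆ (chartAt (Model n) c).source) :
    (C + 1) * ∫ x, η x * weight u x ^ (tau n lam mu + lam - mu) ∂(riemannianVolume n M) +
      ∫ x, ρ x * (weight u x ^ (n * lam + 2 * mu) * mvfderiv (𝓡 n) η x (G x))
        ∂(riemannianVolume n M) ≤ 0 := by
  set α := tau n lam mu + lam - mu with hα
  set k := (n : ℝ) * lam + 2 * mu with hk
  set ν := riemannianVolume n M
  set W := (chartAt (Model n) c).target ∩ (chartAt (Model n) c).symm ⁻¹' {x | ρ x ≠ 0}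
  have hΩo : IsOpen {x | ρ x ≠ 0} := isOpen_ne_fun hρ continuous_const
  have hWo : IsOpen W := (chartAt (Model n) c).isOpen_inter_preimage_symm hΩo
  have hK : IsCompact (chartAt (Model n) c '' tsupport η) :=
    IsCompact.image_of_continuousOn hηc ((chartAt (Model n) c).continuousOn.mono hηsrc)
  have hKW : chartAt (Model n) c '' tsupport η ⊆ W := by
    rintro _ ⟨x, hx, rfl⟩
    refine ⟨(chartAt (Model n) c).map_source (hηsrc hx), ?_⟩
    rw [mem_preimage, (chartAt (Model n) c).left_inv (hηsrc hx)]
    exact hηs hx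
  have hVpos := weight_pos u
  have hVc : ∀ a : ℝ, Continuous fun x => weight u x ^ a := fun a =>
    (contMDiff_weight_rpow hu a).continuous
  have hGle : ∀ᵐ x ∂ν, x ∈ {x | ρ x ≠ 0} → ‖G x‖ ≤ weight u x ^ (lam - mu) := by
    filter_upwards [hGn] with x hx hxΩ
    have h := hx hxΩ
    rw [norm_smul, Real.norm_of_nonneg (Real.rpow_pos_of_pos (hVpos x) _).le] at h
    have h2 : weight u x ^ (lam - mu) * weight u x ^ (mu - lam) = 1 := by
      rw [← Real.rpow_add (hVpos x)]; simp
    refine le_of_eq ?_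
    calc ‖G x‖ = (weight u x ^ (lam - mu) * weight u x ^ (mu - lam)) * ‖G x‖ := by
          rw [h2, one_mul]
      _ = _ := by rw [mul_assoc, h, mul_one]
  obtain ⟨R, B, hR, hR0, hRB, hdRB, hlim⟩ := exists_mollification hWo hK hKW
    (r := ρ ∘ (chartAt (Model n) c).symm)
    (hρ.comp_continuousOn ((chartAt (Model n) c).continuousOn_symm.mono inter_subset_left))
    (fun p _ => hρ0 _) (fun i => hG.isWeakPartialOn hρ c i)
    (fun i S hS hSc => ae_bound_inner_vec (hVc _) hGle c i hS hSc)
  -- With R m the mollified ρ, ψ m = η · R m approximates ρη, `D m` is the product rule for dψ(G),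
  -- and `H m` is the integrand of the Laplacian bound tested with ψ m.
  set D : ℕ → M → ℝ := fun m x => R m (chartAt (Model n) c x) * mvfderiv (𝓡 n) η x (G x) +
    η x * ∑ i : Fin n, coords c x (G x) i *
      fderiv ℝ (R m) (chartAt (Model n) c x) (EuclideanSpace.single i 1)
  set H : ℕ → M → ℝ := fun m x => η x * R m (chartAt (Model n) c x) * (C / ρ x * weight u x ^ α) +
    weight u x ^ k * D m x
  set ψ : ℕ → M → ℝ := fun m x => η x * R m (chartAt (Model n) c x)
  have hψ : ∀ m, ContMDiff (𝓡 n) 𝓘(ℝ, ℝ) ∞ (ψ m) := fun m =>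
    contMDiff_mul_of_tsupport hη hηsrc fun x hx => contMDiffAt_comp_chart hx (hR m).contDiffAt
  have hψc : ∀ m, HasCompactSupport (ψ m) := fun m => hηc.mul_right
  have hψη : ∀ m, tsupport (ψ m) ⊆ tsupport η := fun m => tsupport_mul_subset_left
  have hDψ : ∀ m x, mvfderiv (𝓡 n) (ψ m) x (G x) = D m x := by
    intro m x
    by_cases hx : x ∈ tsupport η
    · have hxs := hηsrc hx
      have hev : ψ m ∘ (chartAt (Model n) c).symm =ᶠ[𝓝 (chartAt (Model n) c x)]
          fun p => (η ∘ (chartAt (Model n) c).symm) p * R m p := by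
        filter_upwards [(chartAt (Model n) c).open_target.mem_nhds
          ((chartAt (Model n) c).map_source hxs)] with p hp
        simp [ψ, (chartAt (Model n) c).right_inv hp]
      have hd1 := (contDiffAt_toChart hη ((chartAt (Model n) c).map_source hxs)).differentiableAt
        (by simp : (∞ : ℕ∞ω) ≠ 0)
      have hd2 := (hR m).differentiable (by simp) (chartAt (Model n) c x)
      simp only [D]
      rw [mvfderiv_eq_sum hxs ((hψ m).mdifferentiableAt (by simp)),
        mvfderiv_eq_sum hxs (hη.mdifferentiableAt (by simp)), hev.fderiv_eq,
        fderiv_fun_mul hd1 hd2, Finset.mul_sum, Finset.mul_sum, ← Finset.sum_add_distrib]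
      refine Finset.sum_congr rfl fun i _ => ?_
      simp only [Function.comp_apply, (chartAt (Model n) c).left_inv hxs, add_apply, smul_apply,
        smul_eq_mul]
      ring
    · simp only [D]
      rw [mvfderiv_of_notMem_tsupport hx, mvfderiv_of_notMem_tsupport fun h => hx (hψη m h),
        image_eq_zero_of_notMem_tsupport hx]
      simp
  have hi1 : ∀ m, Integrable (fun x => ψ m x * (C / ρ x * weight u x ^ α)) ν := fun m => by
    refine (continuous_mul_of_tsupport (hψ m).continuous ((hψη m).trans hηs)
      fun x hx => ?_).integrable_of_hasCompactSupport (hψc m).mul_right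
    exact (continuousAt_const.div hρ.continuousAt hx).mul (hVc α).continuousAt
  have hi2 : ∀ m, Integrable (fun x => weight u x ^ k * D m x) ν := fun m => by
    have := (hG.integrable_mvfderiv hu k (hψ m) (hψc m) ((hψη m).trans hηs)).1
    simpa only [hDψ m] using this
  have hint : ∀ m, Integrable (H m) ν := fun m => (hi1 m).add (hi2 m)
  have hle : ∀ m, ∫ x, H m x ∂ν ≤ 0 := by
    intro m
    have h1 := hlap (ψ m) (hψ m) (hψc m) ((hψη m).trans hηs)
      fun x => mul_nonneg (hη0 x) (hR0 m _)
    have h2 := (hG.integrable_mvfderiv hu k (hψ m) (hψc m) ((hψη m).trans hηs)).2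
    have e1 : ∀ x, C / ρ x * weight u x ^ (lam - mu) * ψ m x * weight u x ^ tau n lam mu =
        ψ m x * (C / ρ x * weight u x ^ α) := fun x => by
      have : weight u x ^ α = weight u x ^ (lam - mu) * weight u x ^ tau n lam mu := by
        rw [← Real.rpow_add (hVpos x), hα]; congr 1; ring
      rw [this]; ring
    have e2 : ∀ x, ρ x * affineLaplacian (n := n) lam mu u (ψ m) x * weight u x ^ tau n lam mu =
        ρ x * divergence (fun y => (weight u y ^ k) • grad (n := n) (ψ m) y) x := fun x => by
      rw [mul_assoc, affineLaplacian_mul_weight hu (hψ m)]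
    simp only [e1, e2] at h1
    simp only [hDψ m] at h2
    have h3 : ∫ x, H m x ∂ν = _ := integral_add (hi1 m) (hi2 m)
    rw [h3, h2]
    linarith
  -- The mollified ρ and its partial derivatives are at most `|B|` on the image of the support of η,
  -- uniformly in m; the remaining factors are independent of m and integrable.
  set bound : M → ℝ := fun x => |B| * (|η x * (C / ρ x * weight u x ^ α)| +
    |weight u x ^ k * mvfderiv (𝓡 n) η x (G x)| +
    ∑ i : Fin n, |weight u x ^ k * η x * coords c x (G x) i|)
  have hbound_int : Integrable bound ν := by
    refine Integrable.const_mul ((Integrable.add ?_ ?_).add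
      (integrable_finsetSum _ fun i _ => ?_)) _
    · refine ((continuous_mul_of_tsupport hη.continuous hηs
        fun x hx => ?_).integrable_of_hasCompactSupport hηc.mul_right).abs
      exact (continuousAt_const.div hρ.continuousAt hx).mul (hVc α).continuousAt
    · exact (hG.integrable_mvfderiv hu k hη hηc hηs).1.abs
    · exact (hG.integrable_coords hu k hη hηc hηs hηsrc i).abs
  have hbound : ∀ m, ∀ x, ‖H m x‖ ≤ bound x := by
    intro m x
    rw [Real.norm_eq_abs]
    by_cases hx : x ∈ tsupport η
    · have b1 := (hRB m _ (mem_image_of_mem _ hx)).trans (le_abs_self B)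
      have b2 := fun i => (hdRB m _ (mem_image_of_mem _ hx) i).trans (le_abs_self B)
      have e : H m x = R m (chartAt (Model n) c x) * (η x * (C / ρ x * weight u x ^ α)) +
          R m (chartAt (Model n) c x) * (weight u x ^ k * mvfderiv (𝓡 n) η x (G x)) +
          ∑ i : Fin n, fderiv ℝ (R m) (chartAt (Model n) c x) (EuclideanSpace.single i 1) *
            (weight u x ^ k * η x * coords c x (G x) i) := by
        simp only [H, D, mul_add, Finset.mul_sum, add_assoc]
        congr 1
        · ring
        · congr 1
          · ring
          · exact Finset.sum_congr rfl fun i _ => by ring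
      rw [e]
      simp only [bound, mul_add, Finset.mul_sum]
      refine (abs_add_le _ _).trans (add_le_add ((abs_add_le _ _).trans (add_le_add ?_ ?_))
        ((Finset.abs_sum_le_sum_abs _ _).trans (Finset.sum_le_sum fun i _ => ?_)))
      · rw [abs_mul]
        exact mul_le_mul_of_nonneg_right b1 (abs_nonneg _)
      · rw [abs_mul]
        exact mul_le_mul_of_nonneg_right b1 (abs_nonneg _)
      · rw [abs_mul]
        exact mul_le_mul_of_nonneg_right (b2 i) (abs_nonneg _)
    · have : H m x = 0 := by
        simp [H, D, image_eq_zero_of_notMem_tsupport hx, mvfderiv_of_notMem_tsupport hx]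
      rw [this, abs_zero]
      positivity
  set L : M → ℝ := fun x => (C + 1) * (η x * weight u x ^ α) +
    ρ x * (weight u x ^ k * mvfderiv (𝓡 n) η x (G x))
  -- In the limit the factor ρ cancels the 1/ρ of the first term, leaving C, and the derivative of ρ
  -- contributes V^k |G|² = V^α, the extra 1 in C + 1.
  have hconv : ∀ᵐ x ∂ν, Filter.Tendsto (fun m => H m x) Filter.atTop (𝓝 (L x)) := by
    filter_upwards [ae_chart_of_ae (c := c) hlim, hGn] with x hx hGx
    by_cases hxη : x ∈ tsupport η
    · have hxs := hηsrc hxη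
      have hρx : ρ x ≠ 0 := hηs hxη
      obtain ⟨t1, t2⟩ := hx hxs (mem_image_of_mem _ hxη)
      have hcomp : ∀ f : M → ℝ, (f ∘ (chartAt (Model n) c).symm) (chartAt (Model n) c x) = f x :=
        fun f => congrArg f ((chartAt (Model n) c).left_inv hxs)
      simp only [hcomp] at t1 t2
      -- The weak partials are the covariant components ⟨G, ∂ᵢ⟩, whereas `coords` gives the
      -- contravariant ones; their pairing is |G|².
      have hsum : ∑ i : Fin n, coords c x (G x) i *
          inner ℝ (G x) (vec c x (EuclideanSpace.single i 1)) = ‖G x‖ ^ 2 := by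
        rw [← real_inner_self_eq_norm_sq]
        have hexp : ∑ i : Fin n, coords c x (G x) i • vec c x (EuclideanSpace.single i 1) =
            G x := by
          conv_rhs => rw [← vec_coords hxs (G x), model_eq_sum (coords c x (G x)), map_sum]
          simp only [map_smul]
        conv_rhs => arg 3; rw [← hexp]
        simp only [inner_sum, inner_smul_right]
      have hnorm : weight u x ^ k * ‖G x‖ ^ 2 = weight u x ^ α := by
        have h := hGx hρx
        rw [norm_smul, Real.norm_of_nonneg (Real.rpow_pos_of_pos (hVpos x) _).le] at h
        have h2 : weight u x ^ k =
            weight u x ^ α * (weight u x ^ (mu - lam) * weight u x ^ (mu - lam)) := by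
          rw [← Real.rpow_add (hVpos x), ← Real.rpow_add (hVpos x), hα, hk, tau]
          congr 1; ring
        rw [h2]
        calc _ = weight u x ^ α * (weight u x ^ (mu - lam) * ‖G x‖) ^ 2 := by ring
          _ = _ := by rw [h]; ring
      have hL : L x = η x * ρ x * (C / ρ x * weight u x ^ α) +
          weight u x ^ k * (ρ x * mvfderiv (𝓡 n) η x (G x) + η x * ∑ i : Fin n,
            coords c x (G x) i * inner ℝ (G x) (vec c x (EuclideanSpace.single i 1))) := by
        rw [hsum, mul_add, mul_left_comm _ (η x), hnorm]
        simp only [L]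
        field_simp
        ring
      rw [hL]
      refine Filter.Tendsto.add ((t1.const_mul _).mul_const _) (Filter.Tendsto.const_mul _ ?_)
      exact (t1.mul_const _).add (Filter.Tendsto.const_mul _
        (tendsto_finsetSum _ fun i _ => (t2 i).const_mul _))
    · have h1 : ∀ m, H m x = 0 := fun m => by
        simp [H, D, image_eq_zero_of_notMem_tsupport hxη, mvfderiv_of_notMem_tsupport hxη]
      have h2 : L x = 0 := by
        simp [L, image_eq_zero_of_notMem_tsupport hxη, mvfderiv_of_notMem_tsupport hxη]
      simp only [h1, h2]
      exact tendsto_const_nhds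
  have hfinal := le_of_tendsto' (tendsto_integral_of_dominated_convergence bound
    (fun m => (hint m).aestronglyMeasurable) hbound_int
    (fun m => Filter.Eventually.of_forall (hbound m)) hconv) hle
  have hηi : Integrable (fun x => η x * weight u x ^ α) ν :=
    (hη.continuous.mul (hVc α)).integrable_of_hasCompactSupport hηc.mul_right
  have h3 : ∫ x, L x ∂ν = _ := integral_add (hηi.const_mul (C + 1))
    (hG.integrable_mul_mvfderiv hu hρ k hη hηc hηs)
  rw [h3, integral_const_mul] at hfinal
  exact hfinal

end LocalEnergy

/-! ### Global energy inequality, Cauchy–Schwarz and the two inequalities. -/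

section Main

/-- The quadratic polynomial t ↦ ∫ (tf + g)² is nonnegative, so its discriminant is nonpositive. -/
theorem sq_integral_mul_le {Y : Type*} [MeasurableSpace Y] {ν : Measure Y} {f g : Y → ℝ}
    (hf : Integrable (fun x => f x ^ 2) ν) (hfg : Integrable (fun x => f x * g x) ν)
    (hg : Integrable (fun x => g x ^ 2) ν) :
    (∫ x, f x * g x ∂ν) ^ 2 ≤ (∫ x, f x ^ 2 ∂ν) * ∫ x, g x ^ 2 ∂ν := by
  have h : ∀ t : ℝ, 0 ≤ (∫ x, f x ^ 2 ∂ν) * (t * t) + (2 * ∫ x, f x * g x ∂ν) * t +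
      ∫ x, g x ^ 2 ∂ν := fun t => by
    have h1 : ∫ x, (f x * t + g x) ^ 2 ∂ν = (∫ x, f x ^ 2 ∂ν) * (t * t) +
        (2 * ∫ x, f x * g x ∂ν) * t + ∫ x, g x ^ 2 ∂ν := by
      have i1 := hf.mul_const (t * t)
      have i2 := (hfg.const_mul 2).mul_const t
      have i3 : Integrable (fun x => f x ^ 2 * (t * t) + 2 * (f x * g x) * t) ν := i1.add i2
      rw [← integral_mul_const, ← integral_const_mul, ← integral_mul_const,
        ← integral_add i1 i2, ← integral_add i3 hg]
      congr 1 with x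
      ring
    rw [← h1]
    exact integral_nonneg fun x => sq_nonneg _
  have := discrim_le_zero h
  rw [discrim] at this
  linarith

theorem sq_integral_mul_le_of_continuous {Y : Type*} [TopologicalSpace Y] [MeasurableSpace Y]
    [OpensMeasurableSpace Y] [T2Space Y] {ν : Measure Y} [IsFiniteMeasureOnCompacts ν]
    {f g : Y → ℝ} (hf : Continuous f)
    (hg : Continuous g) (hfc : HasCompactSupport f) (hgc : HasCompactSupport g) :
    (∫ x, f x * g x ∂ν) ^ 2 ≤ (∫ x, f x ^ 2 ∂ν) * ∫ x, g x ^ 2 ∂ν := by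
  refine sq_integral_mul_le ?_ ((hf.mul hg).integrable_of_hasCompactSupport hfc.mul_right) ?_
  · rw [show (fun x => f x ^ 2) = f * f from funext fun x => sq (f x)]
    exact (hf.mul hf).integrable_of_hasCompactSupport hfc.mul_right
  · rw [show (fun x => g x ^ 2) = g * g from funext fun x => sq (g x)]
    exact (hg.mul hg).integrable_of_hasCompactSupport hgc.mul_right

theorem sq_weight_rpow_half {X : Type*} (u : X → ℝ) (x : X) (a : ℝ) :
    (weight u x ^ (a / 2)) ^ 2 = weight u x ^ a := by
  rw [← Real.rpow_natCast, ← Real.rpow_mul (weight_pos u x).le]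
  simp

variable [RiemannianBundle (fun x : M => TangentSpace (𝓡 n) x)]

theorem hasCompactSupport_affineLaplacian [IsManifold (𝓡 n) ∞ M] [T2Space M]
    {f : M → ℝ} (hfc : HasCompactSupport f)
    (u : M → ℝ) (lam mu : ℝ) : HasCompactSupport (affineLaplacian (n := n) lam mu u f) := by
  refine HasCompactSupport.of_support_subset_isCompact hfc fun x hx => ?_
  by_contra h
  refine hx ?_
  have h1 : laplacian (n := n) f x = 0 := by
    refine divergence_eq_zero_of_eventuallyEq ?_
    filter_upwards [(isClosed_tsupport f).isOpen_compl.mem_nhds h] with y hy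
    rw [grad, mvfderiv_of_notMem_tsupport hy, map_zero]
  have h2 : grad (n := n) f x = 0 := by
    rw [grad, mvfderiv_of_notMem_tsupport h, map_zero]
  rw [affineLaplacian, h1, h2, inner_zero_right]
  simp

variable [IsManifold (𝓡 n) ∞ M]
  [IsContMDiffRiemannianBundle (𝓡 n) ∞ (Model n) (fun x : M => TangentSpace (𝓡 n) x)]

theorem continuous_norm_grad {f : M → ℝ} (hf : ContMDiff (𝓡 n) 𝓘(ℝ, ℝ) ∞ f) :
    Continuous fun x => ‖grad (n := n) f x‖ := by
  have h := ((isSmoothField_grad hf).contMDiff_mvfderiv hf).continuous.sqrt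
  refine h.congr fun x => ?_
  rw [← inner_grad, real_inner_self_eq_norm_sq, Real.sqrt_sq (norm_nonneg _)]

variable [MeasurableSpace M] [BorelSpace M] [T2Space M]
  {u : M → ℝ} {lam mu : ℝ} {ρ : M → ℝ} {G : ∀ x : M, TangentSpace (𝓡 n) x}

/-- Interpolation of the second moment. -/
theorem sq_integral_sq_mul_le (hu : ContMDiff (𝓡 n) 𝓘(ℝ, ℝ) ∞ u) (hρ : Continuous ρ) (a : ℝ)
    {φ : M → ℝ} (hφ : ContMDiff (𝓡 n) 𝓘(ℝ, ℝ) ∞ φ) (hφc : HasCompactSupport φ) :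
    (∫ x, ρ x ^ 2 * φ x ^ 2 * weight u x ^ a ∂(riemannianVolume n M)) ^ 2 ≤
      (∫ x, φ x ^ 2 * weight u x ^ a ∂(riemannianVolume n M)) *
      (∫ x, ρ x ^ 4 * φ x ^ 2 * weight u x ^ a ∂(riemannianVolume n M)) := by
  have hVc := (contMDiff_weight_rpow hu (a / 2)).continuous
  have hφV : Continuous fun x => φ x * weight u x ^ (a / 2) := hφ.continuous.mul hVc
  have hφρ : Continuous fun x => φ x * (ρ x ^ 2 * weight u x ^ (a / 2)) :=
    hφ.continuous.mul (Continuous.mul (hρ.pow 2) hVc)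
  have hcs := sq_integral_mul_le_of_continuous (ν := riemannianVolume n M) hφV hφρ
    (HasCompactSupport.mul_right hφc) (HasCompactSupport.mul_right hφc)
  have e1 : ∀ x, φ x * weight u x ^ (a / 2) * (φ x * (ρ x ^ 2 * weight u x ^ (a / 2))) =
      ρ x ^ 2 * φ x ^ 2 * weight u x ^ a := fun x => by
    rw [← sq_weight_rpow_half u x a]; ring
  have e2 : ∀ x, (φ x * (ρ x ^ 2 * weight u x ^ (a / 2))) ^ 2 =
      ρ x ^ 4 * φ x ^ 2 * weight u x ^ a := fun x => by
    rw [← sq_weight_rpow_half u x a]; ring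
  have e3 : ∀ x, (φ x * weight u x ^ (a / 2)) ^ 2 = φ x ^ 2 * weight u x ^ a := fun x => by
    rw [← sq_weight_rpow_half u x a]; ring
  simpa only [e1, e2, e3] using hcs

variable [SecondCountableTopology M]

/-- Continuity is read off from the divergence form after multiplication by V^(-τ). -/
theorem continuous_affineLaplacian (hu : ContMDiff (𝓡 n) 𝓘(ℝ, ℝ) ∞ u) {f : M → ℝ}
    (hf : ContMDiff (𝓡 n) 𝓘(ℝ, ℝ) ∞ f) (lam mu : ℝ) :
    Continuous (affineLaplacian (n := n) lam mu u f) := by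
  have h := ((isSmoothField_grad hf).smul
    (contMDiff_weight_rpow hu (n * lam + 2 * mu))).contMDiff_divergence.continuous.mul
    (contMDiff_weight_rpow hu (- tau n lam mu)).continuous
  refine h.congr fun x => ?_
  rw [Pi.mul_apply, ← affineLaplacian_mul_weight hu hf, mul_assoc, ← Real.rpow_add (weight_pos u x)]
  simp

/-- The inequality obtained by testing the Laplacian bound with `ρ η`. -/
theorem energy_inequality (hu : ContMDiff (𝓡 n) 𝓘(ℝ, ℝ) ∞ u) (hρ : Continuous ρ)
    (hρ0 : ∀ x, 0 ≤ ρ x) {C : ℝ} (hG : IsWeakGradientOn {x | ρ x ≠ 0} ρ G)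
    (hGn : ∀ᵐ x ∂(riemannianVolume n M), x ∈ {x | ρ x ≠ 0} →
      ‖(weight u x ^ (mu - lam)) • G x‖ = 1)
    (hlap : AffineLaplacianGEOn n {x | ρ x ≠ 0} lam mu u ρ
      (fun x => C / ρ x * weight u x ^ (lam - mu)))
    {η : M → ℝ} (hη : ContMDiff (𝓡 n) 𝓘(ℝ, ℝ) ∞ η) (hηc : HasCompactSupport η)
    (hη0 : ∀ x, 0 ≤ η x) (hηs : tsupport η ⊆ {x | ρ x ≠ 0}) :
    (C + 1) * ∫ x, η x * weight u x ^ (tau n lam mu + lam - mu) ∂(riemannianVolume n M) +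
      ∫ x, ρ x * (weight u x ^ (n * lam + 2 * mu) * mvfderiv (𝓡 n) η x (G x))
        ∂(riemannianVolume n M) ≤ 0 := by
  set P : (M → ℝ) → Prop := fun g => ContMDiff (𝓡 n) 𝓘(ℝ, ℝ) ∞ g ∧ HasCompactSupport g ∧
    tsupport g ⊆ {x | ρ x ≠ 0} ∧
    (C + 1) * ∫ x, g x * weight u x ^ (tau n lam mu + lam - mu) ∂(riemannianVolume n M) +
      ∫ x, ρ x * (weight u x ^ (n * lam + 2 * mu) * mvfderiv (𝓡 n) g x (G x))
        ∂(riemannianVolume n M) ≤ 0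
  suffices h : P η from h.2.2.2
  refine induction_on_charts (n := n) hηc ?_ ?_ ?_
  · refine ⟨contMDiff_const, HasCompactSupport.zero, by simp, ?_⟩
    simp [mvfderiv_zero]
  · rintro g h ⟨hg, hgc, hgs, hgi⟩ ⟨hh, hhc, hhs, hhi⟩
    refine ⟨hg.add hh, hgc.add hhc, (tsupport_add g h).trans (union_subset hgs hhs), ?_⟩
    have i (k : M → ℝ) (hk : ContMDiff (𝓡 n) 𝓘(ℝ, ℝ) ∞ k) (hkc : HasCompactSupport k) :
        Integrable (fun x => k x * weight u x ^ (tau n lam mu + lam - mu))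
          (riemannianVolume n M) :=
      (hk.continuous.mul (contMDiff_weight_rpow hu _).continuous).integrable_of_hasCompactSupport
        hkc.mul_right
    have hd : ∀ x, mvfderiv (𝓡 n) (g + h) x (G x) =
        mvfderiv (𝓡 n) g x (G x) + mvfderiv (𝓡 n) h x (G x) := fun x => by
      rw [mvfderiv_add (hg.mdifferentiableAt (by simp)) (hh.mdifferentiableAt (by simp))]
      rfl
    simp only [hd, Pi.add_apply, add_mul, mul_add]
    rw [integral_add (i g hg hgc) (i h hh hhc),
      integral_add (hG.integrable_mul_mvfderiv hu hρ _ hg hgc hgs)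
        (hG.integrable_mul_mvfderiv hu hρ _ hh hhc hhs)]
    linarith
  -- Nonnegativity of χ keeps χη an admissible, nonnegative test function.
  · intro c χ hχ hχ0 hχs
    have hs : tsupport (χ * η) ⊆ {x | ρ x ≠ 0} := tsupport_mul_subset_right.trans hηs
    exact ⟨hχ.mul hη, hηc.mul_left, hs, local_energy_inequality hu hρ hρ0 hG hGn hlap
      (hχ.mul hη) hηc.mul_left (fun x => mul_nonneg (hχ0 x) (hη0 x)) hs
      (tsupport_mul_subset_left.trans hχs)⟩

/-- The first order Heisenberg–Pauli–Weyl inequality. -/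
theorem heisenberg_first_order (hu : ContMDiff (𝓡 n) 𝓘(ℝ, ℝ) ∞ u) (hρ : Continuous ρ)
    (hρ0 : ∀ x, 0 ≤ ρ x) {C : ℝ} (hC : 0 < C)
    (hgrad : UnitAffineGradientOn n {x | ρ x ≠ 0} lam mu u ρ)
    (hlap : AffineLaplacianGEOn n {x | ρ x ≠ 0} lam mu u ρ
      (fun x => C / ρ x * weight u x ^ (lam - mu)))
    {φ : M → ℝ} (hφ : ContMDiff (𝓡 n) 𝓘(ℝ, ℝ) ∞ φ) (hφc : HasCompactSupport φ)
    (hφs : tsupport φ ⊆ {x | ρ x ≠ 0}) :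
    (C + 1) ^ 2 / 4 *
        (∫ x, φ x ^ 2 * weight u x ^ (tau n lam mu + lam - mu) ∂(riemannianVolume n M)) ^ 2 ≤
      (∫ x, ρ x ^ 2 * φ x ^ 2 * weight u x ^ (tau n lam mu + lam - mu)
          ∂(riemannianVolume n M)) *
      (∫ x, ‖affineGrad (n := n) lam mu u φ x‖ ^ 2 *
          weight u x ^ (tau n lam mu + lam - mu) ∂(riemannianVolume n M)) := by
  obtain ⟨G, hG, hGn⟩ := hgrad
  have hVpos := weight_pos u
  have hVc : ∀ a : ℝ, Continuous fun x => weight u x ^ a := fun a =>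
    (contMDiff_weight_rpow hu a).continuous
  set α := tau n lam mu + lam - mu with hα
  set k := (n : ℝ) * lam + 2 * mu with hk
  set ν := riemannianVolume n M
  have hφ2 : ContMDiff (𝓡 n) 𝓘(ℝ, ℝ) ∞ (φ * φ) := hφ.mul hφ
  have hφ2c : HasCompactSupport (φ * φ) := hφc.mul_right
  have hφ2s : tsupport (φ * φ) ⊆ {x | ρ x ≠ 0} := tsupport_mul_subset_left.trans hφs
  have hE := energy_inequality hu hρ hρ0 hG hGn hlap hφ2 hφ2c (fun x => mul_self_nonneg _) hφ2s
  -- The weight V^α is split evenly between the two Cauchy–Schwarz factors. The absolute value is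
  -- needed because -φ⟨G, ∇φ⟩ is estimated pointwise by |φ| |G| |∇φ|.
  set f : M → ℝ := fun x => |φ x| * (ρ x * weight u x ^ (α / 2))
  set g : M → ℝ := fun x => ‖affineGrad (n := n) lam mu u φ x‖ * weight u x ^ (α / 2)
  have hnorm : ∀ x, ‖affineGrad (n := n) lam mu u φ x‖ =
      weight u x ^ (mu - lam) * ‖grad (n := n) φ x‖ := fun x => by
    rw [affineGrad, norm_smul, Real.norm_of_nonneg (Real.rpow_pos_of_pos (hVpos x) _).le]
  have hf : Continuous f := hφ.continuous.abs.mul (hρ.mul (hVc _))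
  have hfc : HasCompactSupport f :=
    (hφc.comp_left (g := fun t : ℝ => |t|) abs_zero).mul_right
  have hgrad0 : ∀ x ∉ tsupport φ, grad (n := n) φ x = 0 := fun x hx => by
    rw [grad, mvfderiv_of_notMem_tsupport hx, map_zero]
  have hg : Continuous g := by
    simp only [g, hnorm]
    exact ((hVc _).mul (continuous_norm_grad hφ)).mul (hVc _)
  have hgc : HasCompactSupport g := by
    refine HasCompactSupport.of_support_subset_isCompact hφc fun x hx => ?_
    by_contra h
    refine hx ?_
    simp [g, hnorm, hgrad0 x h]
  have hcs := sq_integral_mul_le_of_continuous (ν := ν) hf hg hfc hgc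
  have e1 : ∀ x, f x ^ 2 = ρ x ^ 2 * φ x ^ 2 * weight u x ^ α := fun x => by
    rw [← sq_weight_rpow_half]
    simp only [f, mul_pow, sq_abs]
    ring
  have e2 : ∀ x, g x ^ 2 = ‖affineGrad (n := n) lam mu u φ x‖ ^ 2 * weight u x ^ α := fun x => by
    rw [← sq_weight_rpow_half]
    simp only [g, mul_pow]
  simp only [e1, e2] at hcs
  refine le_trans ?_ hcs
  have hi := hG.integrable_mul_mvfderiv hu hρ k hφ2 hφ2c hφ2s
  have hfg : Integrable (fun x => f x * g x) ν :=
    (hf.mul hg).integrable_of_hasCompactSupport hfc.mul_right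
  have hbd : - ∫ x, ρ x * (weight u x ^ k * mvfderiv (𝓡 n) (φ * φ) x (G x)) ∂ν ≤
      2 * ∫ x, f x * g x ∂ν := by
    rw [← integral_neg, ← integral_const_mul]
    refine integral_mono_ae hi.neg (hfg.const_mul 2) ?_
    filter_upwards [hGn] with x hx
    by_cases hxs : x ∈ tsupport φ
    · have h1 := hx (hφs hxs)
      rw [norm_smul, Real.norm_of_nonneg (Real.rpow_pos_of_pos (hVpos x) _).le] at h1
      have h2 : mvfderiv (𝓡 n) (φ * φ) x (G x) = 2 * (φ x * mvfderiv (𝓡 n) φ x (G x)) := by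
        have hd := hφ.mdifferentiableAt (x := x) (by simp)
        rw [mvfderiv_mul hd hd]
        simp only [add_apply, smul_apply, smul_eq_mul]
        ring
      have h3 : |mvfderiv (𝓡 n) φ x (G x)| ≤ ‖grad (n := n) φ x‖ * ‖G x‖ := by
        rw [← inner_grad]
        exact abs_real_inner_le_norm _ _
      have h4 : weight u x ^ k = weight u x ^ (α / 2) * weight u x ^ (α / 2) *
          (weight u x ^ (mu - lam) * weight u x ^ (mu - lam)) := by
        rw [← Real.rpow_add (hVpos x), ← Real.rpow_add (hVpos x), ← Real.rpow_add (hVpos x),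
          hα, hk, tau]
        congr 1; ring
      -- Inserting the factor V^(μ-λ)|G| = 1 converts V^α V^(μ-λ) into V^k |G|.
      have h5 : f x * g x = ρ x * (weight u x ^ k * (|φ x| * (‖grad (n := n) φ x‖ * ‖G x‖))) := by
        calc f x * g x = f x * g x * (weight u x ^ (mu - lam) * ‖G x‖) := by rw [h1, mul_one]
          _ = _ := by
            rw [h4]
            simp only [f, g, hnorm]
            ring
      rw [h5, h2]
      have h6 : -(φ x * mvfderiv (𝓡 n) φ x (G x)) ≤
          |φ x| * (‖grad (n := n) φ x‖ * ‖G x‖) := by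
        refine (neg_le_abs _).trans ?_
        rw [abs_mul]
        exact mul_le_mul_of_nonneg_left h3 (abs_nonneg _)
      have h7 : 0 ≤ ρ x * weight u x ^ k :=
        mul_nonneg (hρ0 x) (Real.rpow_pos_of_pos (hVpos x) _).le
      have h8 := mul_le_mul_of_nonneg_left h6 h7
      linarith
    · have hx2 : x ∉ tsupport (φ * φ) := fun h => hxs (tsupport_mul_subset_left h)
      rw [mvfderiv_of_notMem_tsupport hx2]
      simp [f, image_eq_zero_of_notMem_tsupport hxs]
  have hsq : ∀ x, (φ * φ) x = φ x ^ 2 := fun x => by simp [sq]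
  simp only [hsq] at hE
  have hA : 0 ≤ ∫ x, φ x ^ 2 * weight u x ^ α ∂ν :=
    integral_nonneg fun x => mul_nonneg (sq_nonneg _) (Real.rpow_pos_of_pos (hVpos x) _).le
  have h1 : (C + 1) * ∫ x, φ x ^ 2 * weight u x ^ α ∂ν ≤ 2 * ∫ x, f x * g x ∂ν := by linarith
  have h2 := pow_le_pow_left₀ (mul_nonneg (by linarith) hA) h1 2
  rw [mul_pow, mul_pow] at h2
  linarith

/-- Interpolation of the affine Dirichlet energy. -/
theorem sq_integral_affineGrad_le (hu : ContMDiff (𝓡 n) 𝓘(ℝ, ℝ) ∞ u)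
    {φ : M → ℝ} (hφ : ContMDiff (𝓡 n) 𝓘(ℝ, ℝ) ∞ φ) (hφc : HasCompactSupport φ) :
    (∫ x, ‖affineGrad (n := n) lam mu u φ x‖ ^ 2 *
        weight u x ^ (tau n lam mu + lam - mu) ∂(riemannianVolume n M)) ^ 2 ≤
      (∫ x, φ x ^ 2 * weight u x ^ (tau n lam mu + lam - mu) ∂(riemannianVolume n M)) *
      (∫ x, affineLaplacian (n := n) lam mu u φ x ^ 2 *
        weight u x ^ (tau n lam mu + mu - lam) ∂(riemannianVolume n M)) := by
  have hVpos := weight_pos u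
  have hVc : ∀ a : ℝ, Continuous fun x => weight u x ^ a := fun a =>
    (contMDiff_weight_rpow hu a).continuous
  set α := tau n lam mu + lam - mu with hα
  set β := tau n lam mu + mu - lam with hβ
  set k := (n : ℝ) * lam + 2 * mu with hk
  have hcs := sq_integral_mul_le_of_continuous (ν := riemannianVolume n M)
    (f := fun x => φ x * weight u x ^ (α / 2))
    (g := fun x => affineLaplacian (n := n) lam mu u φ x * weight u x ^ (β / 2))
    (hφ.continuous.mul (hVc _)) ((continuous_affineLaplacian hu hφ lam mu).mul (hVc _))
    (HasCompactSupport.mul_right hφc)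
    (HasCompactSupport.mul_right (hasCompactSupport_affineLaplacian hφc u lam mu))
  simp only [mul_pow, sq_weight_rpow_half] at hcs
  -- The two weights are centred at τ: (α + β)/2 = τ, so the product of the factors is φ V^τ Δ^D φ,
  -- which is φ times a divergence. Green's formula then turns its integral into minus the affine
  -- Dirichlet energy, and the sign disappears on squaring.
  have e1 : ∀ x, φ x * weight u x ^ (α / 2) *
      (affineLaplacian (n := n) lam mu u φ x * weight u x ^ (β / 2)) =
      φ x * divergence (fun y => (weight u y ^ k) • grad (n := n) φ y) x := fun x => by
    have h : weight u x ^ tau n lam mu = weight u x ^ (α / 2) * weight u x ^ (β / 2) := by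
      rw [← Real.rpow_add (hVpos x), hα, hβ]
      congr 1; ring
    rw [← affineLaplacian_mul_weight hu hφ, h]
    ring
  have e2 : ∀ x, mvfderiv (𝓡 n) φ x ((weight u x ^ k) • grad (n := n) φ x) =
      ‖affineGrad (n := n) lam mu u φ x‖ ^ 2 * weight u x ^ α := fun x => by
    have h : weight u x ^ k =
        weight u x ^ α * (weight u x ^ (mu - lam) * weight u x ^ (mu - lam)) := by
      rw [← Real.rpow_add (hVpos x), ← Real.rpow_add (hVpos x), hα, hk, tau]
      congr 1; ring
    rw [map_smul, ← inner_grad, real_inner_self_eq_norm_sq, affineGrad, norm_smul,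
      Real.norm_of_nonneg (Real.rpow_pos_of_pos (hVpos x) _).le, smul_eq_mul, h]
    ring
  have hgreen := integral_mul_divergence ((isSmoothField_grad hφ).smul
    (contMDiff_weight_rpow hu k)) hφ hφc
  simp only [e2] at hgreen
  simp only [e1, hgreen, neg_sq] at hcs
  exact hcs

/-- Squaring `h` and inserting both interpolation bounds gives q²A⁴ ≤ A²·A₂L, and A² cancels; when A
= 0 the left side is zero. -/
theorem heisenberg_second_order_of_first_order {q A I₁ I₂ A₂ L : ℝ} (hq : 0 ≤ q) (hA : 0 ≤ A)
    (hA₂ : 0 ≤ A₂) (hL : 0 ≤ L) (h : q * A ^ 2 ≤ I₁ * I₂) (h₁ : I₁ ^ 2 ≤ A * A₂)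
    (h₂ : I₂ ^ 2 ≤ A * L) : q ^ 2 * A ^ 2 ≤ A₂ * L := by
  rcases hA.eq_or_lt with rfl | hA'
  · simpa using mul_nonneg hA₂ hL
  · have h3 : (q * A ^ 2) ^ 2 ≤ (I₁ * I₂) ^ 2 := pow_le_pow_left₀ (by positivity) h 2
    have h4 : (I₁ * I₂) ^ 2 ≤ (A * A₂) * (A * L) := by
      rw [mul_pow]
      exact mul_le_mul h₁ h₂ (sq_nonneg _) (mul_nonneg hA hA₂)
    have h5 : A ^ 2 * (q ^ 2 * A ^ 2) ≤ A ^ 2 * (A₂ * L) := by linarith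
    exact le_of_mul_le_mul_left h5 (by positivity)

end Main

end AffineHPW

end

/-! ### The Heisenberg–Pauli–Weyl inequalities of first and second order. -/

theorem mainTheorem9 (n : ℕ) {M : Type*} [TopologicalSpace M] [T2Space M]
    [SecondCountableTopology M] [MeasurableSpace M] [BorelSpace M]
    [ChartedSpace (AffineHPW.Model n) M] [IsManifold (𝓡 n) ∞ M]
    [RiemannianBundle (fun x : M => TangentSpace (𝓡 n) x)]
    [IsContMDiffRiemannianBundle (𝓡 n) ∞ (AffineHPW.Model n)
      (fun x : M => TangentSpace (𝓡 n) x)]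
    (u : M → ℝ) (hu : ContMDiff (𝓡 n) 𝓘(ℝ, ℝ) ∞ u) (lam mu : ℝ)
    (ρ : M → ℝ) (hρ_cont : Continuous ρ) (hρ_nonneg : ∀ x, 0 ≤ ρ x)
    (C : ℝ) (hC : 0 < C)
    (hgrad : AffineHPW.UnitAffineGradientOn n {x | ρ x ≠ 0} lam mu u ρ)
    (hlap : AffineHPW.AffineLaplacianGEOn n {x | ρ x ≠ 0} lam mu u ρ
      (fun x => C / ρ x * AffineHPW.weight u x ^ (lam - mu)))
    (φ : M → ℝ) (hφ : ContMDiff (𝓡 n) 𝓘(ℝ, ℝ) ∞ φ) (hφ_supp : HasCompactSupport φ)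
    (hφ_sub : tsupport φ ⊆ {x | ρ x ≠ 0}) :
    (C + 1) ^ 2 / 4 *
        (∫ x, φ x ^ 2 * AffineHPW.weight u x ^ (AffineHPW.tau n lam mu + lam - mu)
          ∂(AffineHPW.riemannianVolume n M)) ^ 2 ≤
      (∫ x, ρ x ^ 2 * φ x ^ 2 * AffineHPW.weight u x ^ (AffineHPW.tau n lam mu + lam - mu)
          ∂(AffineHPW.riemannianVolume n M)) *
      (∫ x, ‖AffineHPW.affineGrad (n := n) lam mu u φ x‖ ^ 2 *
          AffineHPW.weight u x ^ (AffineHPW.tau n lam mu + lam - mu)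
          ∂(AffineHPW.riemannianVolume n M)) ∧
    (1 < C →
      (C + 1) ^ 4 / 16 *
          (∫ x, φ x ^ 2 * AffineHPW.weight u x ^ (AffineHPW.tau n lam mu + lam - mu)
            ∂(AffineHPW.riemannianVolume n M)) ^ 2 ≤
        (∫ x, ρ x ^ 4 * φ x ^ 2 * AffineHPW.weight u x ^ (AffineHPW.tau n lam mu + lam - mu)
            ∂(AffineHPW.riemannianVolume n M)) *
        (∫ x, AffineHPW.affineLaplacian (n := n) lam mu u φ x ^ 2 *
            AffineHPW.weight u x ^ (AffineHPW.tau n lam mu + mu - lam)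
            ∂(AffineHPW.riemannianVolume n M))) := by
  have h1 := AffineHPW.heisenberg_first_order hu hρ_cont hρ_nonneg hC hgrad hlap hφ hφ_supp hφ_sub
  refine ⟨h1, fun _ => ?_⟩
  have hV : ∀ x, ∀ a : ℝ, 0 ≤ AffineHPW.weight u x ^ a := fun x a =>
    (Real.rpow_pos_of_pos (AffineHPW.weight_pos u x) a).le
  have h2 := AffineHPW.heisenberg_second_order_of_first_order (by positivity)
    (integral_nonneg fun x => mul_nonneg (sq_nonneg _) (hV x _))
    (integral_nonneg fun x => mul_nonneg (by positivity) (hV x _))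
    (integral_nonneg fun x => mul_nonneg (sq_nonneg _) (hV x _)) h1
    (AffineHPW.sq_integral_sq_mul_le hu hρ_cont _ hφ hφ_supp)
    (AffineHPW.sq_integral_affineGrad_le hu hφ hφ_supp)
  have h3 : (C + 1) ^ 4 / 16 = ((C + 1) ^ 2 / 4) ^ 2 := by ring
  rw [h3]
  exact h2
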